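/- Let $\hbar>0$ be irrational, $m\ge 0$, $\mathbf n=(n_1,\dots,n_m)\in\mathbb Z^m$, $|\mathbf n|=n_1+\dots+n_m$, and $w=(w_1,\dots,w_m)\in\mathbb C^m$. Put $\omega_j:=w_j+w_{j+1}+\dots+w_m$ (so $w_j=\omega_j-\omega_{j+1}$, $w_m=\omega_m$) and $\mathrm{sh}(p):=e^p-e^{-p}$. Define the basic quantum polylogarithm $$\mathcal I^\hbar_{\mathbf n}(w_1,\dots,w_m):=i^{|\mathbf n|-m}\int_{(\mathbb R+i0)^m}\prod_{k=1}^m\frac{e^{-i(p_1+\dots+p_k)w_k}}{\mathrm{sh}(\pi p_k)\,\mathrm{sh}(\pi\hbar p_k)}\,\frac{dp_k}{(p_1+\dots+p_k)^{n_k}},$$ where the integral over $(\mathbb R+i0)^m$ is the limit of the integrals over $(\mathbb R+i\delta)^m$ as $\delta\to0^+$. For $\varepsilon=(\varepsilon_1,\dots,\varepsilon_m)\in\{1,\hbar^{-1}\}^m$ put $q_{\varepsilon_j}:=e^{i\pi\hbar}$ if $\varepsilon_j=1$, $q_{\varepsilon_j}:=e^{i\pi/\hbar}$ if $\varepsilon_j=\hbar^{-1}$,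 $[k]_q:=q^k-q^{-k}$, and define the companion polylogarithm series, a sum over the cone $\mathbb Z_{>0}\varepsilon_1\oplus\dots\oplus\mathbb Z_{>0}\varepsilon_m$, $$\mathrm{Li}^\hbar_{\mathbf 1,\mathbf n}(\varepsilon;w):=\varepsilon_1\cdots\varepsilon_m\sum_{k_1,\dots,k_m>0}\ \prod_{j=1}^m\frac{(-1)^{k_j}\,e^{(\varepsilon_1k_1+\dots+\varepsilon_jk_j)w_j}}{[k_j]_{q_{\varepsilon_j}}\,(\varepsilon_1k_1+\dots+\varepsilon_jk_j)^{n_j}} .$$ Theorem. Assume $\mathrm{Re}(\omega_j)<0$ and $|\mathrm{Im}(\omega_j)|<\pi(1+\hbar)$ for all $j$ (in particular, this holds if $\mathrm{Re}(\omega_j)<0$ and $|\mathrm{Im}(\omega_j)|<\pi$ for all $j$). Then: (1) the integrals over $(\mathbb R+i\delta)^m$ converge absolutely for all small $\delta>0$, and the limit defining $\mathcal I^\hbar_{\mathbf n}(w)$ exists; (2) if the $2^m$ companion series converge absolutely at $w$, then $$\mathcal I^\hbar_{\mathbf n}(w_1,\dots,w_m)=\sum_{\varepsilon\in\{1,\hbar^{-1}\}^m}\mathrm{Li}^\hbar_{\mathbf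 1,\mathbf n}(\varepsilon;w_1,\dots,w_m);$$ (3) all $2^m$ companion series converge absolutely at $w$ if $\hbar$ is not exponentially well approximable by rationals, i.e. if for every $\delta>0$ there is $C>0$ with $|b\hbar-a|\ge Ce^{-\delta b}$ for all integers $a$ and $b>0$; (4) for every irrational $\hbar>0$ (without any assumption on convergence of the individual series) there are $R_N\to\infty$ such that the sum over $\varepsilon$ of the partial sums of $\mathrm{Li}^\hbar_{\mathbf 1,\mathbf n}(\varepsilon;w)$ over the $k$ with $\varepsilon_jk_j\le R_N$ for all $j$ tends to $\mathcal I^\hbar_{\mathbf n}(w)$ as $N\to\infty$. -/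

import Mathlib

open MeasureTheory Filter Topology

noncomputable section

namespace QuantumPolylog

/-- The function `sh p = e^p - e^{-p}` (no factor `1/2`). -/
def sh (p : ℂ) : ℂ := Complex.exp p - Complex.exp (-p)

/-- The variables `ω_j = w_j + w_{j+1} + ⋯ + w_m`, so that `w_j = ω_j - ω_{j+1}` and `w_m = ω_m`. -/
def omega {m : ℕ} (w : Fin m → ℂ) (j : Fin m) : ℂ := ∑ i ∈ Finset.Ici j, w i

/-- The integrand
`∏_k e^{-i (p_1 + ⋯ + p_k) w_k} / (sh (π p_k) sh (π h p_k) (p_1 + ⋯ + p_k)^{n_k})`. -/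
def integrand (h : ℝ) {m : ℕ} (n : Fin m → ℤ) (w p : Fin m → ℂ) : ℂ :=
  ∏ k : Fin m,
    Complex.exp (-Complex.I * (∑ j ∈ Finset.Iic k, p j) * w k) /
      (sh (Real.pi * p k) * sh (Real.pi * h * p k) * (∑ j ∈ Finset.Iic k, p j) ^ n k)

/-- The point of the contour `(ℝ + iδ)^m` over `x ∈ ℝ^m`. -/
def contourPoint {m : ℕ} (δ : ℝ) (x : Fin m → ℝ) (j : Fin m) : ℂ := (x j : ℂ) + δ * Complex.I

/-- `i^{|n| - m}` times the integral of the integrand over `(ℝ + iδ)^m`. -/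
def contourIntegral (h : ℝ) {m : ℕ} (n : Fin m → ℤ) (w : Fin m → ℂ) (δ : ℝ) : ℂ :=
  Complex.I ^ ((∑ j, n j) - (m : ℤ)) *
    ∫ x : Fin m → ℝ, integrand h n w (contourPoint δ x)

/-- The basic quantum polylogarithm `I^h_n(w_1, …, w_m)`: the integral over `(ℝ + i0)^m`, that is,
the limit as `δ → 0+` of the integrals over `(ℝ + iδ)^m`. -/
def basicQuantumPolylog (h : ℝ) {m : ℕ} (n : Fin m → ℤ) (w : Fin m → ℂ) : ℂ :=
  limUnder (𝓝[>] (0 : ℝ)) (contourIntegral h n w)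

/-- The two possible entries of `ε`: `false` stands for `1` and `true` for `h⁻¹`. -/
def scale (h : ℝ) (b : Bool) : ℝ := if b then h⁻¹ else 1

/-- The base of the bracket: `q = e^{iπh}` for the entry `1` and `q^∨ = e^{iπ/h}` for `h⁻¹`. -/
def qBase (h : ℝ) (b : Bool) : ℂ :=
  if b then Complex.exp (Complex.I * Real.pi / h) else Complex.exp (Complex.I * Real.pi * h)

/-- The bracket `[k]_q = q^k - q^{-k}`. -/
def bracket (q : ℂ) (k : ℕ) : ℂ := q ^ k - (q ^ k)⁻¹

/-- The partial sums `ε_1 k_1 + ⋯ + ε_j k_j`. -/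
def coneSum (h : ℝ) {m : ℕ} (ε : Fin m → Bool) (k : Fin m → ℕ) (j : Fin m) : ℝ :=
  ∑ i ∈ Finset.Iic j, scale h (ε i) * k i

/-- The term of the companion series `Li^h_{1,n}(ε; w)` at the point `(ε_1 k_1, …, ε_m k_m)` of the
companion cone. -/
def companionTerm (h : ℝ) {m : ℕ} (n : Fin m → ℤ) (ε : Fin m → Bool) (w : Fin m → ℂ)
    (k : Fin m → ℕ) : ℂ :=
  ∏ j : Fin m,
    (scale h (ε j) : ℂ) * ((-1) ^ k j * Complex.exp (coneSum h ε k j * w j) /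
      (bracket (qBase h (ε j)) (k j) * (coneSum h ε k j : ℂ) ^ n j))

/-- The companion series `Li^h_{1,n}(ε; w_1, …, w_m)`, the sum over all `k_1, …, k_m > 0`. -/
def companionLi (h : ℝ) {m : ℕ} (n : Fin m → ℤ) (ε : Fin m → Bool) (w : Fin m → ℂ) : ℂ :=
  ∑' k : Fin m → ℕ+, companionTerm h n ε w (fun j => (k j : ℕ))

/-- Absolute convergence of the companion series (summability in `ℂ` is absolute). -/
def CompanionSummable (h : ℝ) {m : ℕ} (n : Fin m → ℤ) (ε : Fin m → Bool) (w : Fin m → ℂ) : Prop :=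
  Summable fun k : Fin m → ℕ+ => companionTerm h n ε w (fun j => (k j : ℕ))

/-- The partial sum of the companion series over the points of the companion cone in the box
`(0, R]^m`, i.e. over `k_j ≥ 1` with `ε_j k_j ≤ R`. -/
def companionPartial (h : ℝ) {m : ℕ} (n : Fin m → ℤ) (ε : Fin m → Bool) (w : Fin m → ℂ)
    (R : ℝ) : ℂ :=
  ∑ k ∈ Fintype.piFinset fun j => Finset.Icc 1 ⌊R / scale h (ε j)⌋₊, companionTerm h n ε w k

end QuantumPolylog

end

noncomputable section

namespace QuantumPolylog

/-! Summation by parts turns `∑ (p_1 + ⋯ + p_k) w_k` into `∑ p_k ω_k`. The integrand then becomes a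
product of one-variable kernels `kern h (ω_k) (p_k)`, coupled only through the factors `(p_1 + ⋯ +
p_k)^{-n_k}`. By Fubini the integral over `(ℝ + iδ)^m` is an iterate of operators `g ↦ ∫ kern(p) g(z
+ p) / (z + p)^n dp` (`lineOp`), applied to the constant `1` and evaluated at `z = 0`
(`integral_shiftedIntegrand`). These operators preserve the class `Mild` of functions holomorphic in
the open upper half plane with polynomial growth up to the boundary. On the line `Im p = T` they
gain a factor `e^{-cT}`, because `Re ω < 0`; the bound on `Im ω` gives convergence along the line.

The poles of the kernel in the upper half plane are `ik` and `ik/h` with `k ≥ 1`. They are simple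
and distinct because `h` is irrational. Moving one contour from height `δ` to height `T` produces
the finite residue sum `resOp` (`Mild.lineOp_sub_lineOp`). If every contour is moved, the residue
sums iterate to the partial sums of all `2^m` companion series over the box of size `T`, and the
choice of `ε` records which family each pole comes from. By telescoping, the total error is
`O(e^{-cT})` (`exists_iterOp_bounds`), provided that `T` runs through heights uniformly far from the
poles; these exist by `exists_high_farLine`.

Small denominators therefore do not affect the joint box sums: each individual residue may be huge,
but their total is a difference of tame integrals. They matter only for the individual series. There
the distance from `hk` or `k/h` to the nearest integer controls the bracket, and a subexponential
lower bound loses to the decay of `e^{εkω}`. The limit `δ → 0+` is harmless, since there are no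
poles between the real axis and height `min(1, 1/h)`, so the integral does not depend on small `δ`.
-/

/-! ### Cauchy's theorem and residues in a horizontal strip -/

/-- The filter of points going to infinity horizontally inside the strip `t ≤ Im p ≤ T`. -/
def stripEnds (t T : ℝ) : Filter ℂ :=
  comap (fun p : ℂ => |p.re|) atTop ⊓ 𝓟 {p | p.im ∈ Set.Icc t T}

lemma mk_im (x t : ℝ) : ((x : ℂ) + t * Complex.I).im = t := by simp

lemma mk_re (x t : ℝ) : ((x : ℂ) + t * Complex.I).re = x := by simp

lemma tendsto_vertical_integral {f : ℂ → ℂ} {t T : ℝ} (htT : t ≤ T)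
    (hdecay : Tendsto f (stripEnds t T) (𝓝 0)) {u : ℝ → ℝ}
    (hu : Tendsto (fun X => |u X|) atTop atTop) :
    Tendsto (fun X : ℝ => ∫ y : ℝ in t..T, f (u X + y * Complex.I)) atTop (𝓝 0) := by
  rw [Metric.tendsto_nhds]
  intro ε hε
  have h1 : ∀ᶠ p in stripEnds t T, ‖f p‖ < ε / (T - t + 1) := by
    have := (Metric.tendsto_nhds.1 hdecay) (ε / (T - t + 1)) (by
      have : 0 < T - t + 1 := by linarith
      positivity)
    simpa using this
  rw [stripEnds, eventually_inf_principal, eventually_comap] at h1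
  filter_upwards [hu.eventually h1] with X hX
  have hb : ∀ y ∈ Set.uIoc t T, ‖f (u X + y * Complex.I)‖ ≤ ε / (T - t + 1) := by
    intro y hy
    rw [Set.uIoc_of_le htT] at hy
    refine (hX _ (by rw [mk_re]) ?_).le
    rw [mk_im]
    exact ⟨hy.1.le, hy.2⟩
  have := intervalIntegral.norm_integral_le_of_norm_le_const hb
  rw [dist_zero_right]
  refine this.trans_lt ?_
  rw [abs_of_nonneg (by linarith), div_mul_eq_mul_div, div_lt_iff₀ (by linarith)]
  nlinarith

/-- Cauchy's theorem on the rectangle with corners `-X + it` and `X + iT`: the vertical sides have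
fixed length and `f` tends to `0` on them as `X → ∞`. -/
lemma integral_line_eq {f : ℂ → ℂ} {t T : ℝ} (htT : t ≤ T)
    (hd : ∀ p : ℂ, p.im ∈ Set.Icc t T → DifferentiableAt ℂ f p)
    (ht : Integrable fun x : ℝ => f (x + t * Complex.I))
    (hT : Integrable fun x : ℝ => f (x + T * Complex.I))
    (hdecay : Tendsto f (stripEnds t T) (𝓝 0)) :
    ∫ x : ℝ, f (x + t * Complex.I) = ∫ x : ℝ, f (x + T * Complex.I) := by
  have key : ∀ X : ℝ, (∫ x : ℝ in (-X)..X, f (x + t * Complex.I)) -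
      (∫ x : ℝ in (-X)..X, f (x + T * Complex.I)) +
      Complex.I • (∫ y : ℝ in t..T, f ((X : ℝ) + y * Complex.I)) -
      Complex.I • (∫ y : ℝ in t..T, f ((-X : ℝ) + y * Complex.I)) = 0 := by
    intro X
    have := Complex.integral_boundary_rect_eq_zero_of_differentiableOn f
      (((-X : ℝ) : ℂ) + t * Complex.I) ((X : ℂ) + T * Complex.I) (by
        intro p hp
        rw [mk_im, mk_im, Complex.mem_reProdIm, Set.uIcc_of_le htT] at hp
        exact (hd p hp.2).differentiableWithinAt)
    simpa only [mk_im, mk_re] using this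
  have l1 := intervalIntegral_tendsto_integral ht tendsto_neg_atTop_atBot tendsto_id
  have l2 := intervalIntegral_tendsto_integral hT tendsto_neg_atTop_atBot tendsto_id
  have l3 := tendsto_vertical_integral htT hdecay (u := fun X => X) tendsto_abs_atTop_atTop
  have l4 := tendsto_vertical_integral htT hdecay (u := fun X => -X)
    (by simpa using tendsto_abs_atTop_atTop)
  have l := ((l1.sub l2).add (l3.const_smul Complex.I)).sub (l4.const_smul Complex.I)
  have l0 := l.congr key
  have := tendsto_nhds_unique l0 tendsto_const_nhds
  simpa [sub_eq_zero] using this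

/-- A function with a simple pole of residue `1` at `iτ` whose integrals along horizontal lines
in the upper half plane are explicit. -/
def poleFn (τ : ℝ) (p : ℂ) : ℂ := (p - τ * Complex.I)⁻¹ - (p + τ * Complex.I)⁻¹

lemma ne_zero_of_im {p : ℂ} (hp : p.im ≠ 0) : p ≠ 0 := by
  rintro rfl; simp at hp

lemma poleFn_differentiableAt {τ : ℝ} (hτ : 0 < τ) {p : ℂ} (hp : 0 < p.im)
    (h : p ≠ τ * Complex.I) : DifferentiableAt ℂ (poleFn τ) p := by
  have h1 : p - τ * Complex.I ≠ 0 := sub_ne_zero.2 h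
  have h2 : p + τ * Complex.I ≠ 0 := ne_zero_of_im (by simp; linarith)
  unfold poleFn
  fun_prop (disch := assumption)

lemma poleFn_eq {τ : ℝ} (hτ : 0 < τ) {p : ℂ} (hp : 0 < p.im) (h : p ≠ τ * Complex.I) :
    poleFn τ p = 2 * τ * Complex.I * ((p - τ * Complex.I)⁻¹ * (p + τ * Complex.I)⁻¹) := by
  have h1 : p - τ * Complex.I ≠ 0 := sub_ne_zero.2 h
  have h2 : p + τ * Complex.I ≠ 0 := ne_zero_of_im (by simp; linarith)
  unfold poleFn
  field_simp
  ring

lemma integrable_inv_sq_add_sq {s : ℝ} (hs : s ≠ 0) :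
    Integrable fun x : ℝ => (x ^ 2 + s ^ 2)⁻¹ := by
  have := (integrable_inv_one_add_sq.comp_div hs).const_mul (s ^ 2)⁻¹
  refine this.congr (ae_of_all _ fun x => ?_)
  simp only
  rw [← mul_inv]
  congr 1
  field_simp
  ring

lemma integral_inv_sq_add_sq {s : ℝ} (hs : s ≠ 0) :
    ∫ x : ℝ, s * (x ^ 2 + s ^ 2)⁻¹ = |s| / s * Real.pi := by
  have h1 : ∀ x : ℝ, s * (x ^ 2 + s ^ 2)⁻¹ = s⁻¹ * (1 + (x / s) ^ 2)⁻¹ := by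
    intro x
    have : s⁻¹ = s * (s ^ 2)⁻¹ := by field_simp
    rw [this, mul_assoc, ← mul_inv]
    congr 2
    field_simp
    ring
  simp_rw [h1]
  rw [integral_const_mul, Measure.integral_comp_div (fun y : ℝ => (1 + y ^ 2)⁻¹),
    integral_univ_inv_one_add_sq, smul_eq_mul]
  field_simp

/-- The subtracted mirror pole `-iτ` lies outside the upper half plane and improves the decay from
first to second order, which makes the function integrable on lines. Points of the upper half plane
are closer to `iτ` than to `-iτ`. -/
lemma norm_poleFn_le {τ : ℝ} (hτ : 0 < τ) {p : ℂ} (hp : 0 < p.im) (h : p ≠ τ * Complex.I) :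
    ‖poleFn τ p‖ ≤ 2 * τ * (p.re ^ 2 + (p.im - τ) ^ 2)⁻¹ := by
  rw [poleFn_eq hτ hp h]
  have h1 : ‖p - τ * Complex.I‖ ^ 2 = p.re ^ 2 + (p.im - τ) ^ 2 := by
    rw [← Complex.normSq_eq_norm_sq, Complex.normSq_apply]; simp; ring
  have h2 : ‖p + τ * Complex.I‖ ^ 2 = p.re ^ 2 + (p.im + τ) ^ 2 := by
    rw [← Complex.normSq_eq_norm_sq, Complex.normSq_apply]; simp; ring
  have h3 : ‖p - τ * Complex.I‖ ≤ ‖p + τ * Complex.I‖ := by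
    refine (sq_le_sq₀ (norm_nonneg _) (norm_nonneg _)).1 ?_
    rw [h1, h2]; nlinarith [mul_pos hp hτ]
  have h4 : 0 < ‖p - τ * Complex.I‖ := norm_pos_iff.2 (sub_ne_zero.2 h)
  have h5 : ‖(2 * τ * Complex.I : ℂ)‖ = 2 * τ := by simp [abs_of_pos hτ]
  rw [← h1, norm_mul, h5, norm_mul, norm_inv, norm_inv, ← mul_inv, sq]
  gcongr

lemma line_ne {τ t : ℝ} (h : t ≠ τ) (x : ℝ) : (x : ℂ) + t * Complex.I ≠ τ * Complex.I := by
  intro e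
  have := congrArg Complex.im e
  simp at this
  exact h this

lemma integrable_poleFn {τ t : ℝ} (hτ : 0 < τ) (ht : 0 < t) (h : t ≠ τ) :
    Integrable fun x : ℝ => poleFn τ (x + t * Complex.I) := by
  refine ((integrable_inv_sq_add_sq (sub_ne_zero.2 h)).const_mul (2 * τ)).mono' ?_
    (ae_of_all _ fun x => ?_)
  · refine Continuous.aestronglyMeasurable (continuous_iff_continuousAt.2 fun x => ?_)
    exact (poleFn_differentiableAt hτ (by simpa using ht) (line_ne h x)).continuousAt.comp
      (f := fun x : ℝ => (x : ℂ) + t * Complex.I) (by fun_prop)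
  · simpa using norm_poleFn_le (p := (x : ℂ) + t * Complex.I) hτ (by simpa using ht) (line_ne h x)

lemma inv_add_inv_neg {x s : ℝ} (hs : s ≠ 0) :
    ((x : ℂ) + s * Complex.I)⁻¹ + (((-x : ℝ) : ℂ) + s * Complex.I)⁻¹ =
      ((-2 * (s * (x ^ 2 + s ^ 2)⁻¹) : ℝ) : ℂ) * Complex.I := by
  have h1 : (x : ℂ) + s * Complex.I ≠ 0 := ne_zero_of_im (by simpa using hs)
  have h2 : ((-x : ℝ) : ℂ) + s * Complex.I ≠ 0 := ne_zero_of_im (by simpa using hs)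
  have h3 : (x : ℂ) ^ 2 + s ^ 2 ≠ 0 := by
    norm_cast; positivity
  have h4 : ((x : ℂ) + s * Complex.I) * (((-x : ℝ) : ℂ) + s * Complex.I) = -(x ^ 2 + s ^ 2) := by
    push_cast; ring_nf; simp; ring
  rw [inv_add_inv h1 h2, h4]
  push_cast
  field_simp
  ring

/-- Symmetrizing under `x ↦ -x` leaves `i` times a difference of Poisson kernels `s / (x² + s²)`
with `s = t + τ` and `s = t - τ`. Each integrates to `π` times the sign of `s`, so the two cancel
exactly when the line is above the pole. -/
lemma integral_poleFn {τ t : ℝ} (hτ : 0 < τ) (ht : 0 < t) (h : t ≠ τ) :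
    ∫ x : ℝ, poleFn τ (x + t * Complex.I) = if t < τ then 2 * Real.pi * Complex.I else 0 := by
  have hs : t - τ ≠ 0 := sub_ne_zero.2 h
  have hs' : t + τ ≠ 0 := by positivity
  have hsum : ∀ x : ℝ, poleFn τ (x + t * Complex.I) + poleFn τ (((-x : ℝ) : ℂ) + t * Complex.I) =
      ((2 * ((t + τ) * (x ^ 2 + (t + τ) ^ 2)⁻¹ - (t - τ) * (x ^ 2 + (t - τ) ^ 2)⁻¹) : ℝ) : ℂ) *
        Complex.I := by
    intro x
    have e1 := inv_add_inv_neg (x := x) hs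
    have e2 := inv_add_inv_neg (x := x) hs'
    have r1 : ∀ y : ℝ, (y : ℂ) + t * Complex.I - τ * Complex.I =
      y + ((t - τ : ℝ) : ℂ) * Complex.I := fun y => by push_cast; ring
    have r2 : ∀ y : ℝ, (y : ℂ) + t * Complex.I + τ * Complex.I =
      y + ((t + τ : ℝ) : ℂ) * Complex.I := fun y => by push_cast; ring
    simp only [poleFn, r1, r2]
    rw [sub_add_sub_comm, e1, e2]
    push_cast
    ring
  have hint := integrable_poleFn hτ ht h
  have hneg : ∫ x : ℝ, poleFn τ (((-x : ℝ) : ℂ) + t * Complex.I) =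
      ∫ x : ℝ, poleFn τ (x + t * Complex.I) :=
    integral_neg_eq_self (fun x : ℝ => poleFn τ (x + t * Complex.I)) volume
  have h2 : 2 * ∫ x : ℝ, poleFn τ (x + t * Complex.I) =
      ((2 * (Real.pi - |t - τ| / (t - τ) * Real.pi) : ℝ) : ℂ) * Complex.I := by
    rw [two_mul]
    nth_rewrite 2 [← hneg]
    rw [← integral_add hint hint.comp_neg]
    simp_rw [hsum]
    rw [integral_mul_const, integral_complex_ofReal, integral_const_mul,
      integral_sub ((integrable_inv_sq_add_sq hs').const_mul _)
        ((integrable_inv_sq_add_sq hs).const_mul _), integral_inv_sq_add_sq hs,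
      integral_inv_sq_add_sq hs', abs_of_pos (by positivity : 0 < t + τ), div_self hs', one_mul]
  have h3 := mul_left_cancel₀ (two_ne_zero (α := ℂ))
    (h2.trans (by push_cast; ring : _ = (2 : ℂ) *
      (((Real.pi - |t - τ| / (t - τ) * Real.pi : ℝ) : ℂ) * Complex.I)))
  rw [h3]
  split_ifs with hlt
  · rw [abs_of_neg (by linarith), neg_div, div_self hs]
    push_cast; ring
  · have : 0 < t - τ := lt_of_le_of_ne (by linarith) (Ne.symm hs)
    rw [abs_of_pos this, div_self hs]
    simp

lemma tendsto_abs_re_stripEnds (t T : ℝ) :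
    Tendsto (fun p : ℂ => |p.re|) (stripEnds t T) atTop :=
  tendsto_comap.mono_left inf_le_left

lemma eventually_im_stripEnds (t T : ℝ) : ∀ᶠ p in stripEnds t T, p.im ∈ Set.Icc t T :=
  Filter.mem_inf_of_right (mem_principal_self _)

lemma poleFn_tendsto {τ t T : ℝ} (hτ : 0 < τ) (ht : 0 < t) :
    Tendsto (poleFn τ) (stripEnds t T) (𝓝 0) := by
  have hre := tendsto_abs_re_stripEnds t T
  have h1 : Tendsto (fun p : ℂ => 2 * τ * (|p.re| ^ 2)⁻¹) (stripEnds t T) (𝓝 0) := by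
    have := ((tendsto_pow_atTop (α := ℝ) two_ne_zero).comp hre).inv_tendsto_atTop.const_mul (2 * τ)
    simpa using this
  refine squeeze_zero_norm' ?_ h1
  filter_upwards [hre.eventually_gt_atTop 0, eventually_im_stripEnds t T] with p hp hi
  have hp0 : p.re ≠ 0 := abs_pos.1 hp
  refine (norm_poleFn_le hτ (ht.trans_le hi.1) ?_).trans ?_
  · rintro rfl; simp at hp0
  · rw [sq_abs]
    have : 0 < p.re ^ 2 := by positivity
    gcongr
    nlinarith [sq_nonneg (p.im - τ)]

/-- The residue theorem for a horizontal strip in the upper half plane, for finitely many simple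
poles on the imaginary axis. -/
theorem integral_line_sub_integral_line {ι : Type*} {t T : ℝ} (ht : 0 < t) (htT : t ≤ T)
    (s : Finset ι) (τ : ι → ℝ) (r : ι → ℂ) (hτ : ∀ i ∈ s, τ i ∈ Set.Ioo t T)
    (hinj : Set.InjOn τ s) {f : ℂ → ℂ}
    (hd : ∀ p : ℂ, p.im ∈ Set.Icc t T → (∀ i ∈ s, p ≠ τ i * Complex.I) → DifferentiableAt ℂ f p)
    (hr : ∀ i ∈ s, Tendsto (fun p => (p - τ i * Complex.I) * f p) (𝓝[≠] (τ i * Complex.I))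
      (𝓝 (r i)))
    (hft : Integrable fun x : ℝ => f (x + t * Complex.I))
    (hfT : Integrable fun x : ℝ => f (x + T * Complex.I))
    (hdecay : Tendsto f (stripEnds t T) (𝓝 0)) :
    (∫ x : ℝ, f (x + t * Complex.I)) - ∫ x : ℝ, f (x + T * Complex.I) =
      2 * Real.pi * Complex.I * ∑ i ∈ s, r i := by
  classical
  induction s using Finset.induction_on generalizing f with
  | empty =>
    rw [integral_line_eq htT (fun p hp => hd p hp (by simp)) hft hfT hdecay]
    simp
  | insert a s ha ih =>
    obtain ⟨hta, haT⟩ := hτ a (Finset.mem_insert_self a s)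
    have hτa : 0 < τ a := ht.trans hta
    set c : ℂ := τ a * Complex.I with hc
    have hcim : c.im = τ a := by simp [hc]
    -- Subtracting `r a` times the model pole leaves a removable singularity at `c`. The induction
    -- hypothesis applies to the extended function `G`, and the model contributes `2πi * r a`.
    set g : ℂ → ℂ := fun p => f p - r a * poleFn (τ a) p with hg
    have hgd : ∀ p : ℂ, p.im ∈ Set.Icc t T → (∀ i ∈ insert a s, p ≠ τ i * Complex.I) →
        DifferentiableAt ℂ g p := fun p hp hne =>
      (hd p hp hne).sub ((poleFn_differentiableAt hτa (ht.trans_le hp.1)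
        (hne a (Finset.mem_insert_self a s))).const_mul _)
    have hne_a : ∀ i ∈ s, τ i ≠ τ a := fun i hi e => ha (by
      have := hinj (Finset.mem_insert_of_mem hi) (Finset.mem_insert_self a s) e
      rwa [← this])
    have hne_c : ∀ i ∈ s, c ≠ τ i * Complex.I := fun i hi e => hne_a i hi (by
      have := congrArg Complex.im e
      simpa [hc] using this.symm)
    have hnear : ∀ᶠ p in 𝓝[≠] c, DifferentiableAt ℂ g p := by
      have e1 : ∀ᶠ p in 𝓝[≠] c, p.im ∈ Set.Icc t T :=
        (Complex.continuous_im.continuousAt.eventually_mem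
          (Icc_mem_nhds (hcim ▸ hta) (hcim ▸ haT))).filter_mono nhdsWithin_le_nhds
      have e2 : ∀ᶠ p in 𝓝[≠] c, ∀ i ∈ s, p ≠ τ i * Complex.I :=
        ((Finset.eventually_all s).2 fun i hi =>
          (isOpen_ne.eventually_mem (hne_c i hi))).filter_mono nhdsWithin_le_nhds
      filter_upwards [e1, e2, self_mem_nhdsWithin] with p h1 h2 h3
      refine hgd p h1 fun i hi => ?_
      rcases Finset.mem_insert.1 hi with rfl | hi
      · exact h3
      · exact h2 i hi
    have hlim0 : Tendsto (fun p => (p - c) * g p) (𝓝[≠] c) (𝓝 0) := by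
      have h1 := hr a (Finset.mem_insert_self a s)
      have hcc : c + τ a * Complex.I ≠ 0 := ne_zero_of_im (by simp [hc]; linarith)
      have h2 : Tendsto (fun p => r a * (1 - (p - c) * (p + τ a * Complex.I)⁻¹)) (𝓝[≠] c)
          (𝓝 (r a * (1 - (c - c) * (c + τ a * Complex.I)⁻¹))) := by
        refine Tendsto.mono_left ?_ nhdsWithin_le_nhds
        refine ContinuousAt.tendsto (f := fun p => r a * (1 - (p - c) * (p + τ a * Complex.I)⁻¹)) ?_
        fun_prop (disch := assumption)
      have h3 := h1.sub h2
      simp only [sub_self, zero_mul, sub_zero, mul_one] at h3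
      refine h3.congr' ?_
      filter_upwards [self_mem_nhdsWithin] with p hp
      have : p - c ≠ 0 := sub_ne_zero.2 hp
      simp only [hg, poleFn, ← hc]
      field_simp

    -- Riemann's removable singularity theorem: `(p - c) g(p) → 0` makes `g - g c` little-o of `(p -
    -- c)⁻¹`.
    have hlim := Complex.tendsto_limUnder_of_differentiable_on_punctured_nhds_of_isLittleO hnear (by
      have hsub : Tendsto (fun p => (p - c) * (g p - g c)) (𝓝[≠] c) (𝓝 0) := by
        have h0 : Tendsto (fun p : ℂ => (p - c) * g c) (𝓝[≠] c) (𝓝 ((c - c) * g c)) := by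
          refine Tendsto.mono_left ?_ nhdsWithin_le_nhds
          exact Continuous.tendsto (by fun_prop) c
        have := hlim0.sub h0
        simp only [sub_self, zero_mul] at this
        exact this.congr fun p => by ring
      refine (Asymptotics.isLittleO_iff_tendsto' ?_).2 ?_
      · filter_upwards [self_mem_nhdsWithin] with p hp h0
        exact absurd (inv_eq_zero.1 h0) (sub_ne_zero.2 hp)
      · refine hsub.congr fun p => ?_
        rw [div_inv_eq_mul, mul_comm])
    set G : ℂ → ℂ := Function.update g c (limUnder (𝓝[≠] c) g) with hG
    have hGne : ∀ p, p ≠ c → G p = g p := fun p hp => Function.update_of_ne hp _ _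
    have hGev : ∀ p, p ≠ c → G =ᶠ[𝓝 p] g := fun p hp =>
      (isOpen_ne.eventually_mem hp).mono fun q hq => hGne q hq
    have hGev' : G =ᶠ[𝓝[≠] c] g := by
      filter_upwards [self_mem_nhdsWithin] with p hp using hGne p hp
    have hGc : DifferentiableAt ℂ G c := by
      refine (Complex.analyticAt_of_differentiable_on_punctured_nhds_of_continuousAt ?_
        ?_).differentiableAt
      · filter_upwards [hnear, self_mem_nhdsWithin] with p h1 h2
        exact (hGev p h2).differentiableAt_iff.2 h1
      · exact continuousAt_update_same.2 hlim
    have hGline : ∀ y : ℝ, y ≠ τ a → ∀ x : ℝ, G (x + y * Complex.I) = g (x + y * Complex.I) :=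
      fun y hy x => hGne _ (line_ne hy x)
    have hpt := integrable_poleFn hτa ht hta.ne
    have hpT := integrable_poleFn hτa (ht.trans_le htT) haT.ne'
    have key := ih (fun i hi => hτ i (Finset.mem_insert_of_mem hi))
      (hinj.mono (by simp)) (f := G) ?_ ?_ ?_ ?_ ?_
    · simp only [hGline t hta.ne, hGline T haT.ne'] at key
      simp only [hg] at key
      rw [integral_sub hft (hpt.const_mul _), integral_sub hfT (hpT.const_mul _),
        integral_const_mul, integral_const_mul, integral_poleFn hτa ht hta.ne,
        integral_poleFn hτa (ht.trans_le htT) haT.ne', if_pos hta, if_neg haT.not_gt] at key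
      rw [Finset.sum_insert ha]
      linear_combination key
    · intro p hp hne
      by_cases hpc : p = c
      · rw [hpc]; exact hGc
      · refine (hGev p hpc).differentiableAt_iff.2 (hgd p hp fun i hi => ?_)
        rcases Finset.mem_insert.1 hi with rfl | hi
        · exact hpc
        · exact hne i hi
    · intro i hi
      have hic : (τ i * Complex.I : ℂ) ≠ c := (hne_c i hi).symm
      have h1 := hr i (Finset.mem_insert_of_mem hi)
      have h2 : Tendsto (fun p => (p - τ i * Complex.I) * (r a * poleFn (τ a) p))
          (𝓝[≠] (τ i * Complex.I)) (𝓝 ((τ i * Complex.I - τ i * Complex.I) *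
            (r a * poleFn (τ a) (τ i * Complex.I)))) := by
        refine Tendsto.mono_left ?_ nhdsWithin_le_nhds
        have := (poleFn_differentiableAt hτa (p := τ i * Complex.I) (by
          simpa using ht.trans (hτ i (Finset.mem_insert_of_mem hi)).1) hic).continuousAt
        exact ((continuousAt_id.sub continuousAt_const).mul
          (continuousAt_const.mul this)).tendsto
      have h3 := h1.sub h2
      simp only [sub_self, zero_mul, sub_zero] at h3
      refine h3.congr' ?_
      filter_upwards [(hGev _ hic).filter_mono nhdsWithin_le_nhds] with p hp
      rw [hp]
      simp only [hg]
      ring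
    · simp only [hGline t hta.ne]
      exact hft.sub (hpt.const_mul _)
    · simp only [hGline T haT.ne']
      exact hfT.sub (hpT.const_mul _)
    · have h1 := hdecay.sub ((poleFn_tendsto (T := T) hτa ht).const_mul (r a))
      simp only [mul_zero, sub_zero] at h1
      refine h1.congr' ?_
      filter_upwards [(tendsto_abs_re_stripEnds t T).eventually_gt_atTop 0] with p hp
      refine (hGne p ?_).symm
      rintro rfl
      simp [hc] at hp

/-! ### Size of the kernel -/

/-- The one-variable kernel `e^{-ipω} / (sh (πp) sh (πhp))`. -/
def kern (h : ℝ) (ω p : ℂ) : ℂ :=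
  Complex.exp (-Complex.I * p * ω) / (sh (Real.pi * p) * sh (Real.pi * h * p))

/-- Points at which both factors of the denominator of the kernel have their generic size. -/
def PoleFar (h σ : ℝ) (p : ℂ) : Prop :=
  σ * Real.exp (Real.pi * |p.re|) ≤ ‖sh (Real.pi * p)‖ ∧
    σ * Real.exp (Real.pi * h * |p.re|) ≤ ‖sh (Real.pi * h * p)‖

/-- The conditions on `ω` under which the kernel decays. -/
def Admissible (h : ℝ) (ω : ℂ) : Prop := ω.re < 0 ∧ |ω.im| < Real.pi * (1 + h)

/-- The imaginary part of `sh p` is `2 cosh (Re p) sin (Im p)`, and `2 cosh x ≥ e^{|x|}`. -/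
lemma exp_abs_mul_abs_sin_le_norm_sh (p : ℂ) :
    |Real.sin p.im| * Real.exp |p.re| ≤ ‖sh p‖ := by
  refine le_trans ?_ (Complex.abs_im_le_norm _)
  have h1 : (sh p).im = 2 * Real.cosh p.re * Real.sin p.im := by
    rw [sh, Complex.sub_im, Complex.exp_im, Complex.exp_im, Complex.neg_re, Complex.neg_im,
      Real.sin_neg, Real.cosh_eq]
    ring
  rw [h1, abs_mul, mul_comm]
  gcongr
  rw [← Real.cosh_abs, Real.cosh_eq]
  refine le_trans ?_ (le_abs_self _)
  have := Real.exp_pos (-|p.re|)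
  linarith

lemma half_exp_abs_le_norm_sh {p : ℂ} (hp : 1 ≤ |p.re|) :
    1 / 2 * Real.exp |p.re| ≤ ‖sh p‖ := by
  have h1 : |Real.exp p.re - Real.exp (-p.re)| ≤ ‖sh p‖ := by
    have := abs_norm_sub_norm_le (Complex.exp p) (Complex.exp (-p))
    rwa [Complex.norm_exp, Complex.norm_exp, Complex.neg_re] at this
  have h2 : Real.exp |p.re| - Real.exp (-|p.re|) ≤ |Real.exp p.re - Real.exp (-p.re)| := by
    rcases abs_cases p.re with ⟨e, _⟩ | ⟨e, _⟩ <;> rw [e]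
    · exact le_abs_self _
    · rw [neg_neg, abs_sub_comm]; exact le_abs_self _
  have h3 : Real.exp (-|p.re|) ≤ 1 := Real.exp_le_one_iff.2 (by linarith)
  have h4 : 1 + |p.re| ≤ Real.exp |p.re| := by linarith [Real.add_one_le_exp |p.re|]
  linarith

lemma poleFar_of_sin {h σ : ℝ} (hh : 0 < h) {p : ℂ} (h1 : σ ≤ |Real.sin (Real.pi * p.im)|)
    (h2 : σ ≤ |Real.sin (Real.pi * h * p.im)|) : PoleFar h σ p := by
  have e1 := exp_abs_mul_abs_sin_le_norm_sh (Real.pi * p)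
  have e2 := exp_abs_mul_abs_sin_le_norm_sh (Real.pi * h * p)
  have hr : (Real.pi * h * p : ℂ) = ((Real.pi * h : ℝ) : ℂ) * p := by push_cast; ring
  rw [Complex.re_ofReal_mul, Complex.im_ofReal_mul, abs_mul, abs_of_pos Real.pi_pos] at e1
  rw [hr, Complex.re_ofReal_mul, Complex.im_ofReal_mul, abs_mul,
    abs_of_pos (by positivity : 0 < Real.pi * h), ← hr] at e2
  exact ⟨le_trans (by gcongr) e1, le_trans (by gcongr) e2⟩

lemma poleFar_of_re {h : ℝ} (hh : 0 < h) {p : ℂ} (h1 : 1 ≤ Real.pi * |p.re|)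
    (h2 : 1 ≤ Real.pi * h * |p.re|) : PoleFar h (1 / 2) p := by
  have hr : (Real.pi * h * p : ℂ) = ((Real.pi * h : ℝ) : ℂ) * p := by push_cast; ring
  have r1 : |(Real.pi * p : ℂ).re| = Real.pi * |p.re| := by
    rw [Complex.re_ofReal_mul, abs_mul, abs_of_pos Real.pi_pos]
  have r2 : |(Real.pi * h * p : ℂ).re| = Real.pi * h * |p.re| := by
    rw [hr, Complex.re_ofReal_mul, abs_mul, abs_of_pos (by positivity : 0 < Real.pi * h)]
  have e1 := half_exp_abs_le_norm_sh (p := Real.pi * p) (by rwa [r1])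
  have e2 := half_exp_abs_le_norm_sh (p := Real.pi * h * p) (by rwa [r2])
  rw [r1] at e1
  rw [r2] at e2
  exact ⟨e1, e2⟩

/-- The exponential has size `e^{Im p Re ω + Re p Im ω}`, while the denominator is at least `σ²
e^{π(1+h)|Re p|}`. This is the origin of the threshold `π(1 + h)` for `|Im ω|`. -/
lemma norm_kern_le {h σ : ℝ} (hσ : 0 < σ) (ω : ℂ) {p : ℂ} (hp : PoleFar h σ p) :
    ‖kern h ω p‖ ≤ (σ ^ 2)⁻¹ * Real.exp (p.im * ω.re) *
      Real.exp (-(Real.pi * (1 + h) - |ω.im|) * |p.re|) := by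
  have h1 : ‖Complex.exp (-Complex.I * p * ω)‖ ≤
      Real.exp (p.im * ω.re) * Real.exp (|ω.im| * |p.re|) := by
    rw [Complex.norm_exp, ← Real.exp_add, Real.exp_le_exp]
    have : (-Complex.I * p * ω).re = p.im * ω.re + ω.im * p.re := by
      simp [Complex.mul_re, Complex.mul_im]; ring
    rw [this, ← abs_mul]
    linarith [le_abs_self (ω.im * p.re)]
  have h2 : σ ^ 2 * Real.exp (Real.pi * (1 + h) * |p.re|) ≤
      ‖sh (Real.pi * p)‖ * ‖sh (Real.pi * h * p)‖ := by
    have : σ ^ 2 * Real.exp (Real.pi * (1 + h) * |p.re|) =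
        (σ * Real.exp (Real.pi * |p.re|)) * (σ * Real.exp (Real.pi * h * |p.re|)) := by
      rw [show Real.pi * (1 + h) * |p.re| = Real.pi * |p.re| + Real.pi * h * |p.re| by ring,
        Real.exp_add]
      ring
    rw [this]
    exact mul_le_mul hp.1 hp.2 (by positivity) (norm_nonneg _)
  rw [kern, norm_div, norm_mul]
  refine (div_le_div₀ (by positivity) h1 (by positivity) h2).trans (le_of_eq ?_)
  rw [show -(Real.pi * (1 + h) - |ω.im|) * |p.re| =
    |ω.im| * |p.re| - Real.pi * (1 + h) * |p.re| by ring, Real.exp_sub]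
  field_simp

lemma exists_one_add_pow_le_exp (M : ℕ) {c : ℝ} (hc : 0 < c) :
    ∃ C : ℝ, 0 < C ∧ ∀ x : ℝ, 0 ≤ x → (1 + x) ^ M ≤ C * Real.exp (c * x) := by
  refine ⟨M.factorial / c ^ M * Real.exp c, by positivity, fun x hx => ?_⟩
  have h1 := Real.pow_div_factorial_le_exp (c * (1 + x)) (by positivity) M
  rw [mul_pow, mul_add, mul_one, Real.exp_add, div_le_iff₀ (by positivity)] at h1
  have : (1 + x) ^ M = (c ^ M * (1 + x) ^ M) / c ^ M := by field_simp
  rw [this, div_le_iff₀ (by positivity)]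
  refine h1.trans (le_of_eq ?_)
  field_simp

/-- For `n ≥ 0` the distance `δ` from the origin bounds the inverse power; for `n ≤ 0` it is a
polynomial. One bound serves both signs. -/
lemma exists_norm_zpow_inv_le (n : ℤ) {δ : ℝ} (hδ : 0 < δ) :
    ∃ C : ℝ, 0 < C ∧ ∀ u : ℂ, δ ≤ ‖u‖ → ‖u ^ n‖⁻¹ ≤ C * (1 + ‖u‖) ^ n.natAbs := by
  refine ⟨max 1 (δ⁻¹ ^ n.natAbs), by positivity, fun u hu => ?_⟩
  have hu0 : 0 < ‖u‖ := hδ.trans_le hu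
  rw [norm_zpow]
  rcases le_total 0 n with hn | hn
  · obtain ⟨k, rfl⟩ := Int.eq_ofNat_of_zero_le hn
    rw [zpow_natCast, Int.natAbs_natCast, ← inv_pow]
    calc ‖u‖⁻¹ ^ k ≤ δ⁻¹ ^ k := by gcongr
      _ ≤ max 1 (δ⁻¹ ^ k) * 1 := by rw [mul_one]; exact le_max_right _ _
      _ ≤ _ := by
        gcongr
        exact one_le_pow₀ (by linarith)
  · obtain ⟨k, hk⟩ := Int.eq_ofNat_of_zero_le (neg_nonneg.2 hn)
    obtain rfl : n = -k := by omega
    rw [zpow_neg, inv_inv, zpow_natCast, Int.natAbs_neg, Int.natAbs_natCast]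
    calc ‖u‖ ^ k ≤ 1 * (1 + ‖u‖) ^ k := by
          rw [one_mul]; gcongr; linarith
      _ ≤ _ := by gcongr; exact le_max_left _ _

/-- The weight `1 + ‖·‖` is submultiplicative, so growth bounds at `z + p` split into a factor in
`z` and a factor in `p`. -/
lemma one_add_norm_add_le (a b : ℂ) : 1 + ‖a + b‖ ≤ (1 + ‖a‖) * (1 + ‖b‖) := by
  nlinarith [norm_add_le a b, norm_nonneg a, norm_nonneg b,
    mul_nonneg (norm_nonneg a) (norm_nonneg b)]

lemma one_add_norm_le (p : ℂ) : 1 + ‖p‖ ≤ (1 + |p.re|) * (1 + |p.im|) := by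
  nlinarith [Complex.norm_le_abs_re_add_abs_im p, abs_nonneg p.re, abs_nonneg p.im,
    mul_nonneg (abs_nonneg p.re) (abs_nonneg p.im)]

/-- The integrand of one contour integration is exponentially small in the height of the contour
and in the distance from the imaginary axis. -/
lemma exists_norm_kern_mul_le {h : ℝ} {ω : ℂ} (hω : Admissible h ω) (n : ℤ) (N : ℕ)
    {σ δ : ℝ} (hσ : 0 < σ) (hδ : 0 < δ) :
    ∃ C : ℝ, 0 < C ∧ ∃ c : ℝ, 0 < c ∧ ∀ p : ℂ, δ ≤ p.im → PoleFar h σ p →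
      ∀ (A : ℝ) (g : ℂ → ℂ), (∀ u : ℂ, 0 ≤ u.im → ‖g u‖ ≤ A * (1 + ‖u‖) ^ N) →
      ∀ z : ℂ, 0 ≤ z.im → ‖kern h ω p * (g (z + p) / (z + p) ^ n)‖ ≤
        C * A * Real.exp (-c * p.im) * Real.exp (-c * |p.re|) *
          (1 + ‖z‖) ^ (N + n.natAbs) := by
  obtain ⟨hre, him⟩ := hω
  -- Half of the smaller decay rate is kept; the other half absorbs the polynomial factors in `Re p`
  -- and `Im p`.
  set c : ℝ := min (-ω.re) (Real.pi * (1 + h) - |ω.im|) / 2 with hc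
  have hc0 : 0 < c := by
    have : 0 < min (-ω.re) (Real.pi * (1 + h) - |ω.im|) := lt_min (by linarith) (by linarith)
    positivity
  set M := N + n.natAbs with hM
  obtain ⟨C1, hC1, H1⟩ := exists_one_add_pow_le_exp M hc0
  obtain ⟨C2, hC2, H2⟩ := exists_norm_zpow_inv_le n hδ
  refine ⟨(σ ^ 2)⁻¹ * C2 * C1 * C1, by positivity, c, hc0, fun p hp hfar A g hg z hz => ?_⟩
  have hp0 : 0 < p.im := hδ.trans_le hp
  have hu : δ ≤ (z + p).im := by simp; linarith
  have hA : 0 ≤ A := by simpa using (norm_nonneg _).trans (hg 0 (by simp))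
  have k1 := norm_kern_le hσ ω hfar
  have k2 := hg (z + p) (hδ.le.trans hu)
  have k3 := H2 (z + p) (hu.trans ((le_abs_self _).trans (Complex.abs_im_le_norm _)))
  have k4 : (1 + ‖z + p‖) ^ M ≤ (1 + ‖z‖) ^ M *
      ((C1 * Real.exp (c * |p.re|)) * (C1 * Real.exp (c * p.im))) := by
    calc (1 + ‖z + p‖) ^ M ≤ ((1 + ‖z‖) * ((1 + |p.re|) * (1 + |p.im|))) ^ M := by
          gcongr
          exact (one_add_norm_add_le z p).trans (by gcongr; exact one_add_norm_le p)
      _ = (1 + ‖z‖) ^ M * ((1 + |p.re|) ^ M * (1 + p.im) ^ M) := by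
          rw [mul_pow, mul_pow, abs_of_pos hp0]
      _ ≤ _ := by
          gcongr
          · exact H1 _ (abs_nonneg _)
          · exact H1 _ hp0.le
  have e1 : Real.exp (p.im * ω.re) ≤ Real.exp (-(2 * c) * p.im) := by
    rw [Real.exp_le_exp]
    have : 2 * c ≤ -ω.re := by rw [hc, mul_div_cancel₀ _ two_ne_zero]; exact min_le_left _ _
    nlinarith
  have e2 : Real.exp (-(Real.pi * (1 + h) - |ω.im|) * |p.re|) ≤
      Real.exp (-(2 * c) * |p.re|) := by
    rw [Real.exp_le_exp]
    have : 2 * c ≤ Real.pi * (1 + h) - |ω.im| := by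
      rw [hc, mul_div_cancel₀ _ two_ne_zero]; exact min_le_right _ _
    nlinarith [abs_nonneg p.re]
  rw [norm_mul, norm_div, div_eq_mul_inv]
  calc ‖kern h ω p‖ * (‖g (z + p)‖ * ‖(z + p) ^ n‖⁻¹)
      ≤ ((σ ^ 2)⁻¹ * Real.exp (-(2 * c) * p.im) * Real.exp (-(2 * c) * |p.re|)) *
        ((A * (1 + ‖z + p‖) ^ N) * (C2 * (1 + ‖z + p‖) ^ n.natAbs)) := by
        gcongr
        exact k1.trans (by gcongr)
    _ = ((σ ^ 2)⁻¹ * Real.exp (-(2 * c) * p.im) * Real.exp (-(2 * c) * |p.re|)) * A * C2 *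
        (1 + ‖z + p‖) ^ M := by rw [hM, pow_add]; ring
    _ ≤ ((σ ^ 2)⁻¹ * Real.exp (-(2 * c) * p.im) * Real.exp (-(2 * c) * |p.re|)) * A * C2 *
        ((1 + ‖z‖) ^ M * ((C1 * Real.exp (c * |p.re|)) * (C1 * Real.exp (c * p.im)))) := by
        gcongr
    _ = (σ ^ 2)⁻¹ * C2 * C1 * C1 * A * (Real.exp (-(2 * c) * p.im) * Real.exp (c * p.im)) *
        (Real.exp (-(2 * c) * |p.re|) * Real.exp (c * |p.re|)) * (1 + ‖z‖) ^ M := by ring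
    _ = _ := by
        rw [← Real.exp_add, ← Real.exp_add]
        ring_nf

/-! ### One contour integration as an operator on mild functions -/

lemma integrable_exp_neg_mul_abs {c : ℝ} (hc : 0 < c) :
    Integrable fun x : ℝ => Real.exp (-c * |x|) := by
  have h1 : IntegrableOn (fun x : ℝ => Real.exp (-c * |x|)) (Set.Ioi 0) := by
    refine (exp_neg_integrableOn_Ioi 0 hc).congr_fun (fun x hx => ?_) measurableSet_Ioi
    simp only [abs_of_pos (Set.mem_Ioi.1 hx)]
  have h2 : IntegrableOn (fun x : ℝ => Real.exp (-c * |x|)) (Set.Iic 0) := by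
    refine (integrableOn_exp_mul_Iic hc 0).congr_fun (fun x hx => ?_) measurableSet_Iic
    simp only [abs_of_nonpos (Set.mem_Iic.1 hx), mul_neg, neg_mul, neg_neg]
  rw [← integrableOn_univ, ← Set.Iic_union_Ioi (a := (0 : ℝ))]
  exact h2.union h1

/-- Functions holomorphic in the upper half plane, of polynomial growth up to the boundary. -/
structure Mild (N : ℕ) (A : ℝ) (g : ℂ → ℂ) : Prop where
  diff : ∀ u : ℂ, 0 < u.im → DifferentiableAt ℂ g u
  bound : ∀ u : ℂ, 0 ≤ u.im → ‖g u‖ ≤ A * (1 + ‖u‖) ^ N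

lemma Mild.nonneg {N : ℕ} {A : ℝ} {g : ℂ → ℂ} (hg : Mild N A g) : 0 ≤ A := by
  simpa using (norm_nonneg _).trans (hg.bound 0 (by simp))

/-- One contour integration along the line `Im p = T`. -/
def lineOp (h : ℝ) (T : ℝ) (n : ℤ) (ω : ℂ) (g : ℂ → ℂ) (z : ℂ) : ℂ :=
  ∫ x : ℝ, kern h ω (x + T * Complex.I) *
    (g (z + (x + T * Complex.I)) / (z + (x + T * Complex.I)) ^ n)

/-- Lines on which the kernel has no poles, quantitatively. -/
def FarLine (h σ T : ℝ) : Prop := ∀ x : ℝ, PoleFar h σ (x + T * Complex.I)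

lemma PoleFar.ne_zero {h σ : ℝ} (hσ : 0 < σ) {p : ℂ} (hp : PoleFar h σ p) :
    sh (Real.pi * p) ≠ 0 ∧ sh (Real.pi * h * p) ≠ 0 :=
  ⟨norm_pos_iff.1 (lt_of_lt_of_le (by positivity) hp.1),
    norm_pos_iff.1 (lt_of_lt_of_le (by positivity) hp.2)⟩

lemma differentiable_sh : Differentiable ℂ sh := by
  unfold sh
  fun_prop

lemma kern_differentiableAt {h : ℝ} (ω : ℂ) {p : ℂ} (h1 : sh (Real.pi * p) ≠ 0)
    (h2 : sh (Real.pi * h * p) ≠ 0) : DifferentiableAt ℂ (kern h ω) p := by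
  have d1 : DifferentiableAt ℂ (fun p : ℂ => sh (Real.pi * p)) p :=
    (differentiable_sh _).comp p (by fun_prop)
  have d2 : DifferentiableAt ℂ (fun p : ℂ => sh (Real.pi * h * p)) p :=
    (differentiable_sh _).comp p (by fun_prop)
  unfold kern
  exact DifferentiableAt.div (by fun_prop) (d1.mul d2) (mul_ne_zero h1 h2)

lemma continuous_kern_line {h σ T : ℝ} (hσ : 0 < σ) (ω : ℂ) (hT : FarLine h σ T) :
    Continuous fun x : ℝ => kern h ω (x + T * Complex.I) := by
  refine continuous_iff_continuousAt.2 fun x => ?_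
  obtain ⟨h1, h2⟩ := (hT x).ne_zero hσ
  exact (kern_differentiableAt ω h1 h2).continuousAt.comp
    (f := fun x : ℝ => (x : ℂ) + T * Complex.I) (by fun_prop)

lemma Mild.differentiableAt_div {N : ℕ} {A : ℝ} {g : ℂ → ℂ} (hg : Mild N A g) (n : ℤ) {u : ℂ}
    (hu : 0 < u.im) : DifferentiableAt ℂ (fun u => g u / u ^ n) u := by
  have h0 : u ≠ 0 := ne_zero_of_im hu.ne'
  exact (hg.diff u hu).div (differentiableAt_zpow.2 (Or.inl h0)) (zpow_ne_zero _ h0)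

lemma Mild.continuous_integrand {h σ T : ℝ} (hσ : 0 < σ) (hT0 : 0 < T) (hT : FarLine h σ T)
    (ω : ℂ) {N : ℕ} {A : ℝ} {g : ℂ → ℂ} (hg : Mild N A g) (n : ℤ) {z : ℂ} (hz : 0 ≤ z.im) :
    Continuous fun x : ℝ => kern h ω (x + T * Complex.I) *
      (g (z + (x + T * Complex.I)) / (z + (x + T * Complex.I)) ^ n) := by
  refine (continuous_kern_line hσ ω hT).mul (continuous_iff_continuousAt.2 fun x => ?_)
  exact (hg.differentiableAt_div n (u := z + (x + T * Complex.I))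
    (by simp; linarith)).continuousAt.comp
    (f := fun x : ℝ => z + ((x : ℂ) + T * Complex.I)) (by fun_prop)

lemma Mild.integrable {h σ T : ℝ} (hσ : 0 < σ) (hT0 : 0 < T) (hT : FarLine h σ T)
    {ω : ℂ} (hω : Admissible h ω) {N : ℕ} {A : ℝ} {g : ℂ → ℂ} (hg : Mild N A g) (n : ℤ) {z : ℂ}
    (hz : 0 ≤ z.im) :
    Integrable fun x : ℝ => kern h ω (x + T * Complex.I) *
      (g (z + (x + T * Complex.I)) / (z + (x + T * Complex.I)) ^ n) := by
  obtain ⟨C, hC, c, hc, H⟩ := exists_norm_kern_mul_le hω n N hσ hT0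
  refine Integrable.mono' (((integrable_exp_neg_mul_abs hc).const_mul
    (C * A * Real.exp (-c * T))).mul_const ((1 + ‖z‖) ^ (N + n.natAbs)))
    (hg.continuous_integrand hσ hT0 hT ω n hz).aestronglyMeasurable (ae_of_all _ fun x => ?_)
  simpa using H (x + T * Complex.I) (by simp) (hT x) A g hg.bound z hz

lemma Mild.lineOp_differentiableAt {h σ T : ℝ} (hσ : 0 < σ) (hT0 : 0 < T) (hT : FarLine h σ T)
    {ω : ℂ} (hω : Admissible h ω) {N : ℕ} {A : ℝ} {g : ℂ → ℂ} (hg : Mild N A g) (n : ℤ) {z : ℂ}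
    (hz : 0 < z.im) : DifferentiableAt ℂ (lineOp h T n ω g) z := by
  obtain ⟨C, hC, c, hc, H⟩ := exists_norm_kern_mul_le hω n N hσ hT0
  -- The derivative under the integral is bounded by Cauchy's estimate on circles of radius `r`
  -- about points of the ball of radius `r`. These circles stay within `2r` of `z`, hence in the
  -- upper half plane.
  set r : ℝ := z.im / 3 with hr
  have hr0 : 0 < r := by positivity
  have him : ∀ w : ℂ, dist w z ≤ 2 * r → 0 < w.im := by
    intro w hw
    have h1 : |(w - z).im| ≤ 2 * r := (Complex.abs_im_le_norm _).trans (by rwa [← dist_eq_norm])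
    have h2 := (abs_le.1 h1).1
    rw [Complex.sub_im] at h2
    linarith
  set G : ℂ → ℂ := fun u => g u / u ^ n with hG
  have hA := hg.nonneg
  have hGd : ∀ (w : ℂ) (x : ℝ), 0 < w.im →
      HasDerivAt (fun w => kern h ω (x + T * Complex.I) * G (w + (x + T * Complex.I)))
        (kern h ω (x + T * Complex.I) * deriv G (w + (x + T * Complex.I))) w := by
    intro w x hw
    have := (hg.differentiableAt_div n (u := w + (x + T * Complex.I))
      (by simp; linarith)).hasDerivAt
    exact (this.comp_add_const w (x + T * Complex.I)).const_mul _
  refine (hasDerivAt_integral_of_dominated_loc_of_deriv_le (𝕜 := ℂ) (s := Metric.ball z r)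
    (F := fun (w : ℂ) (x : ℝ) => kern h ω (x + T * Complex.I) * G (w + (x + T * Complex.I)))
    (F' := fun (w : ℂ) (x : ℝ) =>
      kern h ω (x + T * Complex.I) * deriv G (w + (x + T * Complex.I)))
    (bound := fun x => C * A * Real.exp (-c * T) * Real.exp (-c * |x|) *
      (1 + (‖z‖ + 2 * r)) ^ (N + n.natAbs) / r)
    (Metric.ball_mem_nhds z hr0) ?_ (hg.integrable hσ hT0 hT hω n hz.le) ?_ ?_ ?_
    ?_).2.differentiableAt
  · filter_upwards [Metric.ball_mem_nhds z hr0] with w hw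
    exact (hg.continuous_integrand hσ hT0 hT ω n
      (him w ((Metric.mem_ball.1 hw).le.trans (by linarith))).le).aestronglyMeasurable
  · refine (continuous_kern_line hσ ω hT).aestronglyMeasurable.mul ?_
    exact ((measurable_deriv G).comp (by fun_prop)).aestronglyMeasurable
  · refine ae_of_all _ fun x w hw => ?_
    have hw' := Metric.mem_ball.1 hw
    rw [← (hGd w x (him w (hw'.le.trans (by linarith)))).deriv]
    refine Complex.norm_deriv_le_of_forall_mem_sphere_norm_le hr0 ?_ ?_
    · refine DifferentiableOn.diffContOnCl fun v hv => ?_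
      rw [closure_ball _ hr0.ne'] at hv
      refine (hGd v x (him v ?_)).differentiableAt.differentiableWithinAt
      linarith [dist_triangle v w z, Metric.mem_closedBall.1 hv]
    · intro v hv
      have hvz : dist v z ≤ 2 * r := by
        linarith [dist_triangle v w z, Metric.mem_sphere.1 hv]
      have := H (x + T * Complex.I) (by simp) (hT x) A g hg.bound v (him v hvz).le
      simp only [mk_im, mk_re] at this
      refine this.trans ?_
      gcongr
      have : ‖v‖ ≤ ‖z‖ + ‖v - z‖ := by
        simpa using norm_add_le z (v - z)
      rw [← dist_eq_norm] at this
      linarith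
  · exact ((((integrable_exp_neg_mul_abs hc).const_mul _).mul_const _).div_const _)
  · refine ae_of_all _ fun x w hw => hGd w x (him w ?_)
    exact (Metric.mem_ball.1 hw).le.trans (by linarith)

/-- The constants `C` and `c` depend on `σ` and `δ` but not on `T` or `g`: this uniformity makes
high contours negligible and lets the estimate be iterated. -/
lemma exists_mild_lineOp {h : ℝ} {ω : ℂ} (hω : Admissible h ω) (n : ℤ) (N : ℕ) {σ δ : ℝ}
    (hσ : 0 < σ) (hδ : 0 < δ) :
    ∃ C : ℝ, 0 < C ∧ ∃ c : ℝ, 0 < c ∧ ∀ T : ℝ, δ ≤ T → FarLine h σ T → ∀ (A : ℝ) (g : ℂ → ℂ),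
      Mild N A g → Mild (N + n.natAbs) (C * A * Real.exp (-c * T)) (lineOp h T n ω g) := by
  obtain ⟨C, hC, c, hc, H⟩ := exists_norm_kern_mul_le hω n N hσ hδ
  have hI : 0 ≤ ∫ x : ℝ, Real.exp (-c * |x|) := integral_nonneg fun x => (Real.exp_pos _).le
  refine ⟨C * (1 + ∫ x : ℝ, Real.exp (-c * |x|)), by positivity, c, hc, fun T hT hfar A g hg =>
    ⟨fun u hu => hg.lineOp_differentiableAt hσ (hδ.trans_le hT) hfar hω n hu, fun z hz => ?_⟩⟩
  have hA := hg.nonneg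
  have h1 : ‖lineOp h T n ω g z‖ ≤ ∫ x : ℝ, C * A * Real.exp (-c * T) * Real.exp (-c * |x|) *
      (1 + ‖z‖) ^ (N + n.natAbs) := by
    refine norm_integral_le_of_norm_le (((integrable_exp_neg_mul_abs hc).const_mul _).mul_const _)
      (ae_of_all _ fun x => ?_)
    simpa using H (x + T * Complex.I) (by simpa using hT) (hfar x) A g hg.bound z hz
  rw [integral_mul_const, integral_const_mul] at h1
  refine h1.trans ?_
  calc C * A * Real.exp (-c * T) * (∫ x : ℝ, Real.exp (-c * |x|)) * (1 + ‖z‖) ^ (N + n.natAbs)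
      ≤ C * A * Real.exp (-c * T) * (1 + ∫ x : ℝ, Real.exp (-c * |x|)) *
        (1 + ‖z‖) ^ (N + n.natAbs) := by
        gcongr
        linarith
    _ = _ := by ring

lemma Mild.kern_mul_tendsto {h : ℝ} (hh : 0 < h) {ω : ℂ} (hω : Admissible h ω) {N : ℕ} {A : ℝ}
    {g : ℂ → ℂ} (hg : Mild N A g) (n : ℤ) {z : ℂ} (hz : 0 ≤ z.im) {t : ℝ} (ht : 0 < t) (T : ℝ) :
    Tendsto (fun p => kern h ω p * (g (z + p) / (z + p) ^ n)) (stripEnds t T) (𝓝 0) := by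
  obtain ⟨C, hC, c, hc, H⟩ := exists_norm_kern_mul_le hω n N (σ := 1 / 2) (by norm_num) ht
  have hre := tendsto_abs_re_stripEnds t T
  have hA := hg.nonneg
  have h1 : Tendsto (fun p : ℂ => C * A * Real.exp (-c * |p.re|) * (1 + ‖z‖) ^ (N + n.natAbs))
      (stripEnds t T) (𝓝 (C * A * 0 * (1 + ‖z‖) ^ (N + n.natAbs))) := by
    refine ((Real.tendsto_exp_atBot.comp ?_).const_mul _).mul_const _
    simpa only [neg_mul, Function.comp_def] using tendsto_neg_atTop_atBot.comp (hre.const_mul_atTop hc)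
  rw [mul_zero, zero_mul] at h1
  refine squeeze_zero_norm' ?_ h1
  filter_upwards [(hre.const_mul_atTop Real.pi_pos).eventually_ge_atTop 1,
    (hre.const_mul_atTop (by positivity : 0 < Real.pi * h)).eventually_ge_atTop 1,
    eventually_im_stripEnds t T] with p h1 h2 h3
  have h4 : Real.exp (-c * p.im) ≤ 1 := Real.exp_le_one_iff.2 (by
    nlinarith [ht.trans_le h3.1])
  have h5 := mul_le_mul_of_nonneg_left h4 (mul_nonneg hC.le hA)
  rw [mul_one] at h5
  refine (H p h3.1 (poleFar_of_re hh h1 h2) A g hg.bound z hz).trans ?_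
  gcongr

/-! ### Poles and residues of the kernel -/

lemma scale_pos {h : ℝ} (hh : 0 < h) (b : Bool) : 0 < scale h b := by
  cases b <;> simp [scale, hh]

/-- `2πi` times the residue of the kernel at the pole `i ε k`. -/
def kernResidue (h : ℝ) (ω : ℂ) (b : Bool) (k : ℕ) : ℂ :=
  Complex.I * ((scale h b : ℂ) * ((-1) ^ k * Complex.exp ((scale h b * k : ℝ) * ω) /
    bracket (qBase h b) k))

/-- The sum over the residues of the kernel at the poles below the line `Im p = R`. -/
def resOp (h : ℝ) (R : ℝ) (n : ℤ) (ω : ℂ) (g : ℂ → ℂ) (z : ℂ) : ℂ :=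
  ∑ b : Bool, ∑ k ∈ Finset.Icc 1 ⌊R / scale h b⌋₊, kernResidue h ω b k *
    (g (z + (scale h b * k : ℝ) * Complex.I) / (z + (scale h b * k : ℝ) * Complex.I) ^ n)

lemma sh_eq_zero {p : ℂ} (hp : sh p = 0) : ∃ k : ℤ, p = k * (Real.pi * Complex.I) := by
  have h1 : Complex.exp (2 * p) = 1 := by
    rw [two_mul, Complex.exp_add]
    nth_rewrite 1 [sub_eq_zero.1 hp]
    rw [← Complex.exp_add]
    simp
  obtain ⟨k, hk⟩ := Complex.exp_eq_one_iff.1 h1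
  exact ⟨k, mul_left_cancel₀ (two_ne_zero (α := ℂ)) (by rw [hk]; ring)⟩

lemma exp_nat_mul_pi_I (k : ℕ) : Complex.exp (k * (Real.pi * Complex.I)) = (-1) ^ k := by
  rw [Complex.exp_nat_mul, Complex.exp_pi_mul_I]

lemma exp_neg_nat_mul_pi_I (k : ℕ) : Complex.exp (-(k * (Real.pi * Complex.I))) = (-1) ^ k := by
  rw [Complex.exp_neg, exp_nat_mul_pi_I, ← inv_pow]
  norm_num

lemma hasDerivAt_sh_mul (s a : ℂ) : HasDerivAt (fun p => sh (s * p))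
    (s * (Complex.exp (s * a) + Complex.exp (-(s * a)))) a := by
  have h1 : HasDerivAt (fun p : ℂ => s * p) s a := by
    simpa using (hasDerivAt_id a).const_mul s
  exact (h1.cexp.sub h1.fun_neg.cexp).congr_deriv (by ring)

lemma tendsto_sub_div_of_hasDerivAt {f : ℂ → ℂ} {a f' : ℂ} (hf : HasDerivAt f f' a)
    (ha : f a = 0) (hf' : f' ≠ 0) :
    Tendsto (fun p => (p - a) / f p) (𝓝[≠] a) (𝓝 f'⁻¹) := by
  refine ((hasDerivAt_iff_tendsto_slope.1 hf).inv₀ hf').congr fun p => ?_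
  rw [slope_def_field, ha, sub_zero, inv_div]

lemma qBase_pow (h : ℝ) (b : Bool) (k : ℕ) : bracket (qBase h b) k =
    sh (if b then Real.pi * (k / h * Complex.I) else Real.pi * h * (k * Complex.I)) := by
  cases b <;> simp only [bracket, qBase, sh, Complex.exp_neg, if_true, if_false, Bool.false_eq_true,
    ← Complex.exp_nat_mul]
  · rw [show (k : ℂ) * (Complex.I * Real.pi * h) = Real.pi * h * (k * Complex.I) by ring]
  · rw [show (k : ℂ) * (Complex.I * Real.pi / h) = Real.pi * (k / h * Complex.I) by ring]

/-- A vanishing bracket would make `hk` or `k/h` an integer. This is where irrationality makes the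
poles simple. -/
lemma bracket_ne_zero {h : ℝ} (hi : Irrational h) (b : Bool) {k : ℕ} (hk : 1 ≤ k) :
    bracket (qBase h b) k ≠ 0 := by
  have hk0 : (k : ℝ) ≠ 0 := by positivity
  have hpi : (Real.pi * Complex.I : ℂ) ≠ 0 :=
    mul_ne_zero (by exact_mod_cast Real.pi_ne_zero) Complex.I_ne_zero
  have hh0 : h ≠ 0 := hi.ne_zero
  intro h0
  rw [qBase_pow] at h0
  obtain ⟨l, hl⟩ := sh_eq_zero h0
  cases b
  · simp only [Bool.false_eq_true, if_false] at hl
    have h1 : (h * k : ℂ) = l := mul_right_cancel₀ hpi (by rw [← hl]; ring)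
    have h2 : h * k = l := by exact_mod_cast h1
    exact hi.ne_rational l k (by field_simp; exact_mod_cast h2)
  · simp only [if_true] at hl
    have h1 : (k / h : ℂ) = l := mul_right_cancel₀ hpi (by rw [← hl]; ring)
    have h2 : k / h = l := by exact_mod_cast h1
    have h3 : (k : ℝ) = l * h := by rw [← h2]; field_simp
    have hl0 : (l : ℝ) ≠ 0 := fun e => hk0 (by rw [h3, e, zero_mul])
    exact hi.ne_rational k l (by field_simp; push_cast; linarith)

/-- At `iεk` one factor of the denominator has a simple zero with derivative `2(-1)^k` times `π` or
`πh`, and the other factor equals the bracket. -/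
lemma kern_residue {h : ℝ} (hi : Irrational h) (ω : ℂ) (b : Bool) {k : ℕ} (hk : 1 ≤ k) :
    Tendsto (fun p => (p - (scale h b * k : ℝ) * Complex.I) * kern h ω p)
      (𝓝[≠] ((scale h b * k : ℝ) * Complex.I))
      (𝓝 ((2 * Real.pi * Complex.I)⁻¹ * kernResidue h ω b k)) := by
  have hpi : (Real.pi : ℂ) ≠ 0 := by exact_mod_cast Real.pi_ne_zero
  have hh0 : (h : ℂ) ≠ 0 := by exact_mod_cast hi.ne_zero
  have hbr := bracket_ne_zero hi b hk
  have hm1 : ((-1 : ℂ) ^ k) ≠ 0 := pow_ne_zero _ (by norm_num)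
  have hm2 : ((-1 : ℂ) ^ k) * (-1) ^ k = 1 := by rw [← mul_pow]; norm_num
  set a : ℂ := (scale h b * k : ℝ) * Complex.I with ha
  have hexp : Tendsto (fun p => Complex.exp (-Complex.I * p * ω)) (𝓝[≠] a)
      (𝓝 (Complex.exp ((scale h b * k : ℝ) * ω))) := by
    have : Complex.exp ((scale h b * k : ℝ) * ω) = Complex.exp (-Complex.I * a * ω) := by
      rw [ha]
      congr 1
      linear_combination ((scale h b * k : ℝ) * ω) * Complex.I_mul_I
    rw [this]
    exact Tendsto.mono_left (Continuous.tendsto (by fun_prop) a) nhdsWithin_le_nhds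
  have hother : ∀ s : ℂ, sh (s * a) ≠ 0 → Tendsto (fun p => (sh (s * p))⁻¹) (𝓝[≠] a)
      (𝓝 (sh (s * a))⁻¹) := by
    intro s hs
    refine Tendsto.inv₀ (Tendsto.mono_left ?_ nhdsWithin_le_nhds) hs
    exact (hasDerivAt_sh_mul s a).continuousAt.tendsto
  have hzero : ∀ s : ℂ, s ≠ 0 → s * a = k * (Real.pi * Complex.I) →
      Tendsto (fun p => (p - a) / sh (s * p)) (𝓝[≠] a) (𝓝 (s * (2 * (-1) ^ k))⁻¹) := by
    intro s hs hsa
    have hd := hasDerivAt_sh_mul s a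
    rw [hsa, exp_nat_mul_pi_I, exp_neg_nat_mul_pi_I, ← two_mul] at hd
    refine tendsto_sub_div_of_hasDerivAt hd ?_ (mul_ne_zero hs (mul_ne_zero two_ne_zero hm1))
    rw [hsa, sh, exp_nat_mul_pi_I, exp_neg_nat_mul_pi_I, sub_self]
  cases b
  · have e0 : a = k * Complex.I := by simp [ha, scale]
    have e1 : sh (Real.pi * h * a) = bracket (qBase h false) k := by rw [qBase_pow, e0]; simp
    have l := ((hzero Real.pi hpi (by rw [e0]; ring)).mul
      (hother (Real.pi * h) (by rw [e1]; exact hbr))).mul hexp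
    rw [e1] at l
    convert l using 2
    · rw [kern]; field_simp
    · rw [kernResidue]
      simp only [scale, Bool.false_eq_true, if_false, Complex.ofReal_one]
      field_simp
      linear_combination hm2
  · have e0 : a = k / h * Complex.I := by simp [ha, scale]; ring
    have e1 : sh (Real.pi * a) = bracket (qBase h true) k := by rw [qBase_pow, e0]; simp
    have l := ((hzero (Real.pi * h) (mul_ne_zero hpi hh0) (by rw [e0]; field_simp)).mul
      (hother Real.pi (by rw [e1]; exact hbr))).mul hexp
    rw [e1] at l
    convert l using 2
    · rw [kern]; field_simp
    · rw [kernResidue]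
      simp only [scale, if_true, Complex.ofReal_inv]
      field_simp
      linear_combination hm2

lemma sh_pole {h : ℝ} (hh : h ≠ 0) (b : Bool) (k : ℕ) :
    sh (Real.pi * ((scale h b * k : ℝ) * Complex.I)) = 0 ∨
      sh (Real.pi * h * ((scale h b * k : ℝ) * Complex.I)) = 0 := by
  have hh' : (h : ℂ) ≠ 0 := by exact_mod_cast hh
  have h0 : sh (k * (Real.pi * Complex.I)) = 0 := by
    rw [sh, exp_nat_mul_pi_I, exp_neg_nat_mul_pi_I, sub_self]
  cases b
  · left
    rw [← h0]
    congr 1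
    simp only [scale, Bool.false_eq_true, if_false]
    push_cast
    ring
  · right
    rw [← h0]
    congr 1
    simp only [scale, if_true]
    push_cast
    field_simp

lemma exists_pole_of_sh_eq_zero {h : ℝ} (hh : 0 < h) {p : ℂ} (hp : 0 < p.im)
    (h0 : sh (Real.pi * p) = 0 ∨ sh (Real.pi * h * p) = 0) :
    ∃ (b : Bool) (k : ℕ), 1 ≤ k ∧ p = (scale h b * k : ℝ) * Complex.I := by
  have hpi : (Real.pi : ℂ) ≠ 0 := by exact_mod_cast Real.pi_ne_zero
  have hh' : (h : ℂ) ≠ 0 := by exact_mod_cast hh.ne'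
  have aux : ∀ (b : Bool) (l : ℤ), p = (scale h b * l : ℝ) * Complex.I →
      ∃ (b : Bool) (k : ℕ), 1 ≤ k ∧ p = (scale h b * k : ℝ) * Complex.I := by
    intro b l hl
    have h1 : 0 < scale h b * l := by
      rw [hl] at hp
      simpa using hp
    have h2 : (0 : ℝ) < l := (pos_iff_pos_of_mul_pos h1).1 (scale_pos hh b)
    have h3 : 0 < l := by exact_mod_cast h2
    obtain ⟨k, rfl⟩ := Int.eq_ofNat_of_zero_le h3.le
    exact ⟨b, k, by omega, by simpa using hl⟩
  rcases h0 with h0 | h0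
  · obtain ⟨l, hl⟩ := sh_eq_zero h0
    refine aux false l (mul_left_cancel₀ hpi ?_)
    rw [hl]
    simp only [scale, Bool.false_eq_true, if_false]
    push_cast
    ring
  · obtain ⟨l, hl⟩ := sh_eq_zero h0
    refine aux true l (mul_left_cancel₀ (mul_ne_zero hpi hh') ?_)
    rw [hl]
    simp only [scale, if_true]
    push_cast
    field_simp

lemma FarLine.ne_pole {h σ T : ℝ} (hh : h ≠ 0) (hσ : 0 < σ) (hT : FarLine h σ T) (b : Bool)
    (k : ℕ) : scale h b * k ≠ T := by
  intro e
  have h1 := (hT 0).ne_zero hσ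
  have h2 := sh_pole hh b k
  rw [e] at h2
  simp only [Complex.ofReal_zero, zero_add] at h1
  exact h2.elim h1.1 h1.2

lemma pole_injective {h : ℝ} (hi : Irrational h) {b b' : Bool} {k k' : ℕ} (hk : 1 ≤ k)
    (hk' : 1 ≤ k') (e : scale h b * k = scale h b' * k') : b = b' ∧ k = k' := by
  have hh0 := hi.ne_zero
  have key : ∀ k k' : ℕ, 1 ≤ k → 1 ≤ k' → scale h false * k ≠ scale h true * k' := by
    intro k k' hk hk' e
    have hk0 : (k : ℝ) ≠ 0 := by positivity
    simp only [scale, Bool.false_eq_true, if_false, if_true, one_mul] at e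
    refine hi.ne_rational k' k ?_
    field_simp at e ⊢
    push_cast
    linarith
  cases b <;> cases b'
  · simpa [scale] using e
  · exact absurd e (key k k' hk hk')
  · exact absurd e.symm (key k' k hk' hk)
  · simpa [scale, hh0] using e

/-- Moving the contour of one integration upwards picks up the residues in between. -/
theorem Mild.lineOp_sub_lineOp {h : ℝ} (hh : 0 < h) (hi : Irrational h) {ω : ℂ}
    (hω : Admissible h ω) {N : ℕ} {A : ℝ} {g : ℂ → ℂ} (hg : Mild N A g) (n : ℤ) {σ t T : ℝ}
    (hσ : 0 < σ) (ht : 0 < t) (htT : t ≤ T) (hts : ∀ b, t < scale h b) (hft : FarLine h σ t)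
    (hfT : FarLine h σ T) {z : ℂ} (hz : 0 ≤ z.im) :
    lineOp h t n ω g z - lineOp h T n ω g z = resOp h T n ω g z := by
  have hpi : (2 * Real.pi * Complex.I : ℂ) ≠ 0 := by simp [Real.pi_ne_zero]
  -- These are all the poles of the strip: every pole lies above height `t` by `hts`, and none lies
  -- on the line at height `T` by `hfT`.
  set s : Finset (Σ _ : Bool, ℕ) :=
    Finset.univ.sigma fun b => Finset.Icc 1 ⌊T / scale h b⌋₊ with hs
  have hmem : ∀ (b : Bool) (k : ℕ), (⟨b, k⟩ : Σ _ : Bool, ℕ) ∈ s ↔ 1 ≤ k ∧ scale h b * k ≤ T := by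
    intro b k
    simp only [hs, Finset.mem_sigma, Finset.mem_univ, true_and, Finset.mem_Icc]
    refine and_congr_right fun _ => ?_
    rw [Nat.le_floor_iff (div_nonneg (ht.le.trans htT) (scale_pos hh b).le),
      le_div_iff₀ (scale_pos hh b), mul_comm]
  have key := integral_line_sub_integral_line ht htT s (fun i => scale h i.1 * i.2)
    (fun i => (2 * Real.pi * Complex.I)⁻¹ * kernResidue h ω i.1 i.2 *
      (g (z + (scale h i.1 * i.2 : ℝ) * Complex.I) /
        (z + (scale h i.1 * i.2 : ℝ) * Complex.I) ^ n))
    (f := fun p => kern h ω p * (g (z + p) / (z + p) ^ n)) ?_ ?_ ?_ ?_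
    (hg.integrable hσ ht hft hω n hz) (hg.integrable hσ (ht.trans_le htT) hfT hω n hz)
    (hg.kern_mul_tendsto hh hω n hz ht T)
  · refine key.trans ?_
    rw [hs, Finset.sum_sigma, Finset.mul_sum, resOp]
    refine Finset.sum_congr rfl fun b _ => ?_
    rw [Finset.mul_sum]
    refine Finset.sum_congr rfl fun k _ => ?_
    simp only
    rw [mul_assoc _ (kernResidue h ω b k), mul_inv_cancel_left₀ hpi]
  · rintro ⟨b, k⟩ hik
    obtain ⟨hk, hkT⟩ := (hmem b k).1 hik
    refine ⟨(hts b).trans_le (le_mul_of_one_le_right (scale_pos hh b).le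
      (by exact_mod_cast hk)), lt_of_le_of_ne hkT (hfT.ne_pole hh.ne' hσ b k)⟩
  · rintro ⟨b, k⟩ hik ⟨b', k'⟩ hik' e
    obtain ⟨rfl, rfl⟩ := pole_injective hi ((hmem b k).1 hik).1 ((hmem b' k').1 hik').1 e
    rfl
  · intro p hp hne
    have hp0 : 0 < p.im := ht.trans_le hp.1
    have hnz : ¬(sh (Real.pi * p) = 0 ∨ sh (Real.pi * h * p) = 0) := by
      intro h0
      obtain ⟨b, k, hk, e⟩ := exists_pole_of_sh_eq_zero hh hp0 h0
      refine hne ⟨b, k⟩ ((hmem b k).2 ⟨hk, ?_⟩) e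
      have := hp.2
      rw [e] at this
      simpa using this
    obtain ⟨h1, h2⟩ := not_or.1 hnz
    refine (kern_differentiableAt ω h1 h2).mul ?_
    exact (hg.differentiableAt_div n (u := z + p) (by simp; linarith)).comp p
      (f := fun p => z + p) (by fun_prop)
  · rintro ⟨b, k⟩ hik
    obtain ⟨hk, -⟩ := (hmem b k).1 hik
    have hpos : 0 < scale h b * k := mul_pos (scale_pos hh b) (by exact_mod_cast hk)
    have l1 := kern_residue hi ω b hk
    have l2 : Tendsto (fun p => g (z + p) / (z + p) ^ n)
        (𝓝[≠] ((scale h b * k : ℝ) * Complex.I))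
        (𝓝 (g (z + (scale h b * k : ℝ) * Complex.I) /
          (z + (scale h b * k : ℝ) * Complex.I) ^ n)) := by
      refine Tendsto.mono_left ?_ nhdsWithin_le_nhds
      have hd := hg.differentiableAt_div n (u := z + (scale h b * k : ℝ) * Complex.I)
        (by rw [Complex.add_im, Complex.im_ofReal_mul, Complex.I_im, mul_one]; linarith)
      exact (hd.comp ((scale h b * k : ℝ) * Complex.I : ℂ)
        (f := fun p => z + p) (by fun_prop)).continuousAt.tendsto
    exact (l1.mul l2).congr fun p => by ring

/-! ### Iterating the operators and moving all contours -/

/-- The composition of `m` one-variable operators, applied to the constant function `1`. -/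
def iterOp (L : ℤ → ℂ → (ℂ → ℂ) → ℂ → ℂ) : (m : ℕ) → (Fin m → ℤ) → (Fin m → ℂ) → ℂ → ℂ
  | 0, _, _ => fun _ => 1
  | m + 1, n, ω => L (n 0) (ω 0) (iterOp L m (Fin.tail n) (Fin.tail ω))

/-- The difference of the integrations along two horizontal lines. -/
def stripOp (h t T : ℝ) (n : ℤ) (ω : ℂ) (g : ℂ → ℂ) (z : ℂ) : ℂ :=
  lineOp h t n ω g z - lineOp h T n ω g z

lemma Mild.mono {N : ℕ} {A B : ℝ} {g : ℂ → ℂ} (hg : Mild N A g) (hAB : A ≤ B) : Mild N B g :=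
  ⟨hg.diff, fun u hu => (hg.bound u hu).trans (by gcongr)⟩

lemma Mild.sub {N : ℕ} {A B : ℝ} {g g' : ℂ → ℂ} (hg : Mild N A g) (hg' : Mild N B g') :
    Mild N (A + B) fun z => g z - g' z :=
  ⟨fun u hu => (hg.diff u hu).sub (hg'.diff u hu), fun u hu => by
    rw [add_mul]
    exact (norm_sub_le _ _).trans (add_le_add (hg.bound u hu) (hg'.bound u hu))⟩

lemma mild_one : Mild 0 1 fun _ => 1 := ⟨fun _ _ => by fun_prop, fun _ _ => by simp⟩

lemma Mild.lineOp_sub {h σ T : ℝ} (hσ : 0 < σ) (hT0 : 0 < T) (hT : FarLine h σ T)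
    {ω : ℂ} (hω : Admissible h ω) {N : ℕ} {A B : ℝ} {g g' : ℂ → ℂ} (hg : Mild N A g)
    (hg' : Mild N B g') (n : ℤ) {z : ℂ} (hz : 0 ≤ z.im) :
    lineOp h T n ω (fun u => g u - g' u) z = lineOp h T n ω g z - lineOp h T n ω g' z := by
  unfold lineOp
  rw [← integral_sub (hg.integrable hσ hT0 hT hω n hz) (hg'.integrable hσ hT0 hT hω n hz)]
  congr 1
  funext x
  rw [← mul_sub, ← sub_div]

lemma lineOp_congr (h : ℝ) {T : ℝ} (hT : 0 < T) (n : ℤ) (ω : ℂ) {g g' : ℂ → ℂ}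
    (hgg : ∀ u : ℂ, 0 ≤ u.im → g u = g' u) {z : ℂ} (hz : 0 ≤ z.im) :
    lineOp h T n ω g z = lineOp h T n ω g' z := by
  unfold lineOp
  congr 1
  funext x
  rw [hgg _ (by simp; linarith)]

lemma resOp_congr {h : ℝ} (hh : 0 < h) (R : ℝ) (n : ℤ) (ω : ℂ) {g g' : ℂ → ℂ}
    (hgg : ∀ u : ℂ, 0 ≤ u.im → g u = g' u) {z : ℂ} (hz : 0 ≤ z.im) :
    resOp h R n ω g z = resOp h R n ω g' z := by
  unfold resOp
  refine Finset.sum_congr rfl fun b _ => Finset.sum_congr rfl fun k _ => ?_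
  have := scale_pos hh b
  rw [hgg _ (by
    rw [Complex.add_im, Complex.im_ofReal_mul, Complex.I_im, mul_one]; positivity)]

/-- Iterated integrals over low contours and their differences with high contours have polynomial
growth, and the contribution of high contours is exponentially small. -/
theorem exists_iterOp_bounds {h σ δ : ℝ} (hσ : 0 < σ) (hδ : 0 < δ) (hfδ : FarLine h σ δ)
    (m : ℕ) (n : Fin m → ℤ) (ω : Fin m → ℂ) (hω : ∀ j, Admissible h (ω j)) :
    ∃ (N : ℕ) (A B c : ℝ), 0 < c ∧ 0 ≤ B ∧ ∀ T : ℝ, δ ≤ T → FarLine h σ T →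
      Mild N A (iterOp (lineOp h δ) m n ω) ∧ Mild N A (iterOp (stripOp h δ T) m n ω) ∧
      ∀ z : ℂ, 0 ≤ z.im → ‖iterOp (stripOp h δ T) m n ω z - iterOp (lineOp h δ) m n ω z‖ ≤
        B * Real.exp (-c * T) * (1 + ‖z‖) ^ N := by
  induction m with
  | zero =>
    refine ⟨0, 1, 0, 1, one_pos, le_rfl, fun T _ _ => ⟨mild_one, mild_one, fun z _ => ?_⟩⟩
    simp [iterOp]
  | succ m ih =>
    obtain ⟨N, A, B, c, hc, hB, H⟩ := ih (Fin.tail n) (Fin.tail ω) fun j => hω j.succ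
    obtain ⟨C1, hC1, c1, hc1, H1⟩ := exists_mild_lineOp (hω 0) (n 0) N hσ hδ
    have hA : 0 ≤ A := (H δ le_rfl hfδ).1.nonneg
    refine ⟨N + (n 0).natAbs, C1 * A + C1 * A, C1 * B + C1 * A, min c c1, lt_min hc hc1,
      by positivity, fun T hT hfT => ?_⟩
    obtain ⟨hI, hX, hXI⟩ := H T hT hfT
    have hT0 : 0 < T := hδ.trans_le hT
    have le1 : ∀ {D y : ℝ}, 0 ≤ D → 0 < y → D * Real.exp (-c1 * y) ≤ D := fun hD hy =>
      mul_le_of_le_one_right hD (Real.exp_le_one_iff.2 (by nlinarith))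
    have hCA : 0 ≤ C1 * A := by positivity
    have hIδ := (H1 δ le_rfl hfδ A _ hI).mono (le1 hCA hδ)
    have hXδ := (H1 δ le_rfl hfδ A _ hX).mono (le1 hCA hδ)
    have hXT := H1 T hT hfT A _ hX
    refine ⟨hIδ.mono (by linarith), hXδ.sub (hXT.mono (le1 hCA hT0)), fun z hz => ?_⟩
    -- With `X` and `I` the strip and line iterates in `m` variables, the new difference is `L_δ X -
    -- L_T X - L_δ I = L_δ (X - I) - L_T X`. The first term is small because `X - I` is a mild
    -- function with an exponentially small constant, the second because its contour is high.
    have hD : Mild N (B * Real.exp (-c * T)) fun z => iterOp (stripOp h δ T) m (Fin.tail n)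
        (Fin.tail ω) z - iterOp (lineOp h δ) m (Fin.tail n) (Fin.tail ω) z :=
      ⟨(hX.sub hI).diff, hXI⟩
    have hDδ := ((H1 δ le_rfl hfδ _ _ hD).mono (le1 (by positivity) hδ)).bound z hz
    rw [hX.lineOp_sub hσ hδ hfδ (hω 0) hI (n 0) hz] at hDδ
    have e1 : Real.exp (-c * T) ≤ Real.exp (-min c c1 * T) := by
      rw [Real.exp_le_exp]; nlinarith [min_le_left c c1]
    have e2 : Real.exp (-c1 * T) ≤ Real.exp (-min c c1 * T) := by
      rw [Real.exp_le_exp]; nlinarith [min_le_right c c1]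
    simp only [iterOp]
    calc ‖stripOp h δ T (n 0) (ω 0) (iterOp (stripOp h δ T) m (Fin.tail n) (Fin.tail ω)) z -
          lineOp h δ (n 0) (ω 0) (iterOp (lineOp h δ) m (Fin.tail n) (Fin.tail ω)) z‖
        ≤ C1 * (B * Real.exp (-c * T)) * (1 + ‖z‖) ^ (N + (n 0).natAbs) +
          C1 * A * Real.exp (-c1 * T) * (1 + ‖z‖) ^ (N + (n 0).natAbs) := by
          rw [stripOp, sub_right_comm]
          exact (norm_sub_le _ _).trans (add_le_add hDδ (hXT.bound z hz))
      _ ≤ C1 * (B * Real.exp (-min c c1 * T)) * (1 + ‖z‖) ^ (N + (n 0).natAbs) +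
          C1 * A * Real.exp (-min c c1 * T) * (1 + ‖z‖) ^ (N + (n 0).natAbs) := by gcongr
      _ = _ := by ring

lemma iterOp_stripOp_eq {h σ δ T : ℝ} (hh : 0 < h) (hi : Irrational h) (hσ : 0 < σ) (hδ : 0 < δ)
    (hδs : ∀ b, δ < scale h b) (hfδ : FarLine h σ δ) (hT : δ ≤ T) (hfT : FarLine h σ T)
    (m : ℕ) (n : Fin m → ℤ) (ω : Fin m → ℂ) (hω : ∀ j, Admissible h (ω j)) {z : ℂ}
    (hz : 0 ≤ z.im) : iterOp (stripOp h δ T) m n ω z = iterOp (resOp h T) m n ω z := by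
  induction m generalizing z with
  | zero => rfl
  | succ m ih =>
    obtain ⟨N, A, B, c, -, -, H⟩ := exists_iterOp_bounds hσ hδ hfδ m (Fin.tail n) (Fin.tail ω)
      fun j => hω j.succ
    obtain ⟨-, hX, -⟩ := H T hT hfT
    exact (hX.lineOp_sub_lineOp hh hi (hω 0) (n 0) hσ hδ hT hδs hfδ hfT hz).trans
      (resOp_congr hh T _ _ (fun u hu => ih _ _ (fun j => hω j.succ) hu) hz)

/-- Below height `min(1, 1/h)` there are no poles, so every residue sum is empty. -/
lemma iterOp_lineOp_eq {h σ δ T : ℝ} (hh : 0 < h) (hi : Irrational h) (hσ : 0 < σ) (hδ : 0 < δ)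
    (hTs : ∀ b, T < scale h b) (hfδ : FarLine h σ δ) (hT : δ ≤ T) (hfT : FarLine h σ T)
    (m : ℕ) (n : Fin m → ℤ) (ω : Fin m → ℂ) (hω : ∀ j, Admissible h (ω j)) {z : ℂ}
    (hz : 0 ≤ z.im) : iterOp (lineOp h δ) m n ω z = iterOp (lineOp h T) m n ω z := by
  induction m generalizing z with
  | zero => rfl
  | succ m ih =>
    obtain ⟨N, A, B, c, -, -, H⟩ := exists_iterOp_bounds hσ hδ hfδ m (Fin.tail n) (Fin.tail ω)
      fun j => hω j.succ
    obtain ⟨hI, -, -⟩ := H T hT hfT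
    have h1 := hI.lineOp_sub_lineOp hh hi (hω 0) (n 0) hσ hδ hT (fun b => hT.trans_lt (hTs b))
      hfδ hfT hz
    have h2 : ∀ b, ⌊T / scale h b⌋₊ = 0 := fun b =>
      Nat.floor_eq_zero.2 ((div_lt_one (scale_pos hh b)).2 (hTs b))
    simp only [resOp, h2] at h1
    refine (sub_eq_zero.1 (h1.trans (by simp))).trans ?_
    exact lineOp_congr h (hδ.trans_le hT) _ _ (fun u hu => ih _ _ (fun j => hω j.succ) hu) hz

/-! ### The multiple integral as an iterated one -/

/-- The integrand with all partial sums shifted by `z`, written in terms of the `ω_j`. -/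
def shiftedIntegrand (h : ℝ) {m : ℕ} (n : Fin m → ℤ) (ω : Fin m → ℂ) (z : ℂ) (p : Fin m → ℂ) : ℂ :=
  ∏ k : Fin m, kern h (ω k) (p k) / (z + ∑ j ∈ Finset.Iic k, p j) ^ n k

lemma sum_Iic_succ {M : Type*} [AddCommMonoid M] {m : ℕ} (a : Fin (m + 1) → M) (k : Fin m) :
    ∑ j ∈ Finset.Iic k.succ, a j = a 0 + ∑ j ∈ Finset.Iic k, a j.succ := by
  have h1 : ∀ {l : ℕ} (b : Fin l → M) (i : Fin l),
      ∑ j ∈ Finset.Iic i, b j = ∑ j, if j ≤ i then b j else 0 := by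
    intro l b i
    rw [← Finset.sum_filter]
    congr 1
    ext j
    simp
  rw [h1, h1, Fin.sum_univ_succ]
  simp

lemma sum_Iic_zero {M : Type*} [AddCommMonoid M] {m : ℕ} (a : Fin (m + 1) → M) :
    ∑ j ∈ Finset.Iic (0 : Fin (m + 1)), a j = a 0 := by
  have : Finset.Iic (0 : Fin (m + 1)) = {0} := by ext j; simp
  rw [this, Finset.sum_singleton]

/-- Summation by parts: exchanging the two sums over `j ≤ k` replaces the `w_k` by their tails `ω_j`
and decouples the variables in the exponential. -/
lemma sum_sum_Iic_mul {m : ℕ} (a w : Fin m → ℂ) :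
    ∑ k, (∑ j ∈ Finset.Iic k, a j) * w k = ∑ j, a j * omega w j := by
  simp_rw [Finset.sum_mul, omega, Finset.mul_sum]
  exact Finset.sum_comm' (by simp)

lemma integrand_eq (h : ℝ) {m : ℕ} (n : Fin m → ℤ) (w p : Fin m → ℂ) :
    integrand h n w p = shiftedIntegrand h n (omega w) 0 p := by
  have hexp : ∏ k, Complex.exp (-Complex.I * (∑ j ∈ Finset.Iic k, p j) * w k) =
      ∏ k, Complex.exp (-Complex.I * p k * omega w k) := by
    rw [← Complex.exp_sum, ← Complex.exp_sum]
    congr 1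
    simp_rw [mul_assoc, ← Finset.mul_sum]
    rw [sum_sum_Iic_mul]
  unfold integrand shiftedIntegrand kern
  simp_rw [div_div, zero_add]
  rw [Finset.prod_div_distrib, Finset.prod_div_distrib, hexp]

/-- The first variable enters the remaining factors only by shifting `z` to `z + p 0`. This
recursion is the reason for carrying the shift `z`, and it is that of `iterOp`. -/
lemma shiftedIntegrand_succ (h : ℝ) {m : ℕ} (n : Fin (m + 1) → ℤ) (ω : Fin (m + 1) → ℂ) (z : ℂ)
    (p : Fin (m + 1) → ℂ) : shiftedIntegrand h n ω z p =
      kern h (ω 0) (p 0) * (shiftedIntegrand h (Fin.tail n) (Fin.tail ω) (z + p 0)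
        (fun j => p j.succ) / (z + p 0) ^ n 0) := by
  unfold shiftedIntegrand
  rw [Fin.prod_univ_succ, sum_Iic_zero]
  simp_rw [sum_Iic_succ, add_assoc]
  simp only [Fin.tail]
  ring

lemma measurable_shiftedIntegrand (h δ : ℝ) {m : ℕ} (n : Fin m → ℤ) (ω : Fin m → ℂ) :
    Measurable fun q : ℂ × (Fin m → ℝ) => shiftedIntegrand h n ω q.1 (contourPoint δ q.2) := by
  have hk : ∀ ω, Measurable (kern h ω) := fun ω => by
    unfold kern sh
    fun_prop
  have hz : ∀ n : ℤ, Measurable fun u : ℂ => u ^ n := by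
    intro n
    cases n with
    | ofNat k =>
      simp only [Int.ofNat_eq_natCast, zpow_natCast]
      fun_prop
    | negSucc k =>
      simp only [zpow_negSucc]
      fun_prop
  unfold shiftedIntegrand contourPoint
  refine Finset.measurable_prod _ fun k _ => Measurable.div ?_ ?_
  · exact (hk _).comp (by fun_prop)
  · exact (hz _).comp (by fun_prop)

/-- The majorant must grow only polynomially in `z`, since `z` becomes `z + p 0` in the next step
and the growth has to be absorbed by the decay of the next kernel. -/
lemma exists_shiftedIntegrand_bound {h σ δ : ℝ} (hσ : 0 < σ) (hδ : 0 < δ) (hfδ : FarLine h σ δ)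
    {m : ℕ} (n : Fin m → ℤ) (ω : Fin m → ℂ) (hω : ∀ j, Admissible h (ω j)) :
    ∃ (N : ℕ) (G : (Fin m → ℝ) → ℝ), Integrable G ∧ ∀ z : ℂ, 0 ≤ z.im → ∀ x,
      ‖shiftedIntegrand h n ω z (contourPoint δ x)‖ ≤ G x * (1 + ‖z‖) ^ N := by
  induction m with
  | zero =>
    refine ⟨0, fun _ => 1, ?_, fun z _ x => by simp [shiftedIntegrand]⟩
    rw [volume_pi, Measure.pi_of_empty]
    exact integrable_const _
  | succ m ih =>
    obtain ⟨N, G, hG, H⟩ := ih (Fin.tail n) (Fin.tail ω) fun j => hω j.succ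
    obtain ⟨C, hC, c, hc, H1⟩ := exists_norm_kern_mul_le (hω 0) (n 0) N hσ hδ
    have hprod := (((integrable_exp_neg_mul_abs hc).const_mul
      (C * Real.exp (-c * δ))).mul_prod hG)
    refine ⟨N + (n 0).natAbs, fun x => C * Real.exp (-c * δ) * Real.exp (-c * |x 0|) *
      G fun j => x j.succ, ?_, fun z hz x => ?_⟩
    · exact ((volume_preserving_piFinSuccAbove (fun _ : Fin (m + 1) => ℝ) 0).integrable_comp_emb
        (MeasurableEquiv.measurableEmbedding _)).2 hprod
    · rw [shiftedIntegrand_succ]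
      -- The remaining variables are frozen: their majorant `G` plays the role of the constant `A`.
      have := H1 (contourPoint δ x 0) (by simp [contourPoint]) (hfδ (x 0)) (G fun j => x j.succ)
        (fun u => shiftedIntegrand h (Fin.tail n) (Fin.tail ω) u
          (contourPoint δ fun j => x j.succ)) (fun u hu => H u hu _) z hz
      refine this.trans (le_of_eq ?_)
      simp only [contourPoint, mk_im, mk_re]
      ring

lemma integrable_shiftedIntegrand {h σ δ : ℝ} (hσ : 0 < σ) (hδ : 0 < δ) (hfδ : FarLine h σ δ)
    {m : ℕ} (n : Fin m → ℤ) (ω : Fin m → ℂ) (hω : ∀ j, Admissible h (ω j)) {z : ℂ}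
    (hz : 0 ≤ z.im) :
    Integrable fun x : Fin m → ℝ => shiftedIntegrand h n ω z (contourPoint δ x) := by
  obtain ⟨N, G, hG, H⟩ := exists_shiftedIntegrand_bound hσ hδ hfδ n ω hω
  refine Integrable.mono' (hG.mul_const ((1 + ‖z‖) ^ N)) ?_ (ae_of_all _ fun x => H z hz x)
  exact ((measurable_shiftedIntegrand h δ n ω).comp measurable_prodMk_left).aestronglyMeasurable

/-- The integral over `(ℝ + iδ)^m` is an iterated one-variable integral. -/
theorem integral_shiftedIntegrand {h σ δ : ℝ} (hσ : 0 < σ) (hδ : 0 < δ) (hfδ : FarLine h σ δ)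
    {m : ℕ} (n : Fin m → ℤ) (ω : Fin m → ℂ) (hω : ∀ j, Admissible h (ω j)) {z : ℂ}
    (hz : 0 ≤ z.im) :
    ∫ x : Fin m → ℝ, shiftedIntegrand h n ω z (contourPoint δ x) =
      iterOp (lineOp h δ) m n ω z := by
  induction m generalizing z with
  | zero =>
    rw [volume_pi, Measure.pi_of_empty]
    simp [shiftedIntegrand, iterOp]
  | succ m ih =>
    set F : ℝ × (Fin m → ℝ) → ℂ := fun q => kern h (ω 0) (q.1 + δ * Complex.I) *
      (shiftedIntegrand h (Fin.tail n) (Fin.tail ω) (z + (q.1 + δ * Complex.I))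
        (contourPoint δ q.2) / (z + (q.1 + δ * Complex.I)) ^ n 0) with hF
    have hmp := volume_preserving_piFinSuccAbove (fun _ : Fin (m + 1) => ℝ) 0
    have hcomp : ∀ x : Fin (m + 1) → ℝ, shiftedIntegrand h n ω z (contourPoint δ x) =
        F (MeasurableEquiv.piFinSuccAbove (fun _ : Fin (m + 1) => ℝ) 0 x) := fun x =>
      shiftedIntegrand_succ h n ω z (contourPoint δ x)
    have hint : Integrable F := by
      refine (hmp.integrable_comp_emb (MeasurableEquiv.measurableEmbedding _)).1 ?_
      exact (integrable_shiftedIntegrand hσ hδ hfδ n ω hω hz).congr (ae_of_all _ hcomp)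
    simp_rw [hcomp]
    rw [hmp.integral_comp' F]
    refine (integral_prod F hint).trans ?_
    rw [iterOp, lineOp]
    congr 1
    funext a
    simp only [hF]
    rw [integral_const_mul, integral_div]
    have hz' : 0 ≤ (z + (a + δ * Complex.I)).im := by
      rw [Complex.add_im, mk_im]
      linarith
    rw [ih (Fin.tail n) (Fin.tail ω) (fun j => hω j.succ) hz']

/-! ### Residue sums are partial sums of the companion series -/

/-- The terms of the iterated residue sum. -/
def residueTerm (h : ℝ) {m : ℕ} (n : Fin m → ℤ) (ω : Fin m → ℂ) (z : ℂ) (ε : Fin m → Bool)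
    (k : Fin m → ℕ) : ℂ :=
  ∏ j : Fin m, kernResidue h (ω j) (ε j) (k j) /
    (z + ∑ i ∈ Finset.Iic j, (scale h (ε i) * k i : ℝ) * Complex.I) ^ n j

lemma residueTerm_succ (h : ℝ) {m : ℕ} (n : Fin (m + 1) → ℤ) (ω : Fin (m + 1) → ℂ) (z : ℂ)
    (ε : Fin (m + 1) → Bool) (k : Fin (m + 1) → ℕ) :
    residueTerm h n ω z ε k = kernResidue h (ω 0) (ε 0) (k 0) *
      (residueTerm h (Fin.tail n) (Fin.tail ω) (z + (scale h (ε 0) * k 0 : ℝ) * Complex.I)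
        (fun j => ε j.succ) (fun j => k j.succ) /
        (z + (scale h (ε 0) * k 0 : ℝ) * Complex.I) ^ n 0) := by
  unfold residueTerm
  rw [Fin.prod_univ_succ, sum_Iic_zero]
  simp_rw [sum_Iic_succ, add_assoc]
  simp only [Fin.tail]
  ring

lemma sum_piFinset_cons {M : Type*} [AddCommMonoid M] {m : ℕ} (S : Finset ℕ)
    (S' : Fin m → Finset ℕ) (f : (Fin (m + 1) → ℕ) → M) :
    ∑ k ∈ Fintype.piFinset (Fin.cons S S' : Fin (m + 1) → Finset ℕ), f k =
      ∑ l ∈ S, ∑ k ∈ Fintype.piFinset S', f (Fin.cons l k) := by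
  rw [← Finset.sum_product']
  symm
  refine Finset.sum_equiv (Fin.consEquiv fun _ => ℕ) ?_ (fun _ _ => rfl)
  rintro ⟨l, k⟩
  simp [Fin.forall_fin_succ, Fin.consEquiv]

lemma iterOp_resOp (h R : ℝ) {m : ℕ} (n : Fin m → ℤ) (ω : Fin m → ℂ) (z : ℂ) :
    iterOp (resOp h R) m n ω z = ∑ ε : Fin m → Bool,
      ∑ k ∈ Fintype.piFinset fun j => Finset.Icc 1 ⌊R / scale h (ε j)⌋₊,
        residueTerm h n ω z ε k := by
  induction m generalizing z with
  | zero => simp [iterOp, residueTerm]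
  | succ m ih =>
    rw [← (Fin.consEquiv fun _ => Bool).sum_comp, Fintype.sum_prod_type, iterOp, resOp]
    refine Finset.sum_congr rfl fun b _ => ?_
    have hS : ∀ ε : Fin m → Bool, (fun j => Finset.Icc 1
        ⌊R / scale h ((Fin.consEquiv fun _ : Fin (m + 1) => Bool) (b, ε) j)⌋₊) =
        Fin.cons (Finset.Icc 1 ⌊R / scale h b⌋₊)
          (fun j => Finset.Icc 1 ⌊R / scale h (ε j)⌋₊) := by
      intro ε
      funext j
      refine Fin.cases ?_ (fun i => ?_) j <;> simp [Fin.consEquiv]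
    simp_rw [hS, sum_piFinset_cons]
    rw [Finset.sum_comm]
    refine Finset.sum_congr rfl fun l _ => ?_
    rw [ih, Finset.sum_div, Finset.mul_sum]
    refine Finset.sum_congr rfl fun ε _ => ?_
    rw [Finset.sum_div, Finset.mul_sum]
    refine Finset.sum_congr rfl fun k _ => ?_
    rw [residueTerm_succ]
    simp only [Fin.consEquiv, Equiv.coe_fn_mk, Fin.cons_zero, Fin.cons_succ]

lemma companionTerm_eq (h : ℝ) {m : ℕ} (n : Fin m → ℤ) (ε : Fin m → Bool) (w : Fin m → ℂ)
    (k : Fin m → ℕ) : companionTerm h n ε w k = ∏ j : Fin m,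
      (scale h (ε j) : ℂ) * ((-1) ^ k j * Complex.exp ((scale h (ε j) * k j : ℝ) * omega w j) /
        (bracket (qBase h (ε j)) (k j) * (coneSum h ε k j : ℂ) ^ n j)) := by
  have hexp : ∏ j, Complex.exp (coneSum h ε k j * w j) =
      ∏ j, Complex.exp ((scale h (ε j) * k j : ℝ) * omega w j) := by
    rw [← Complex.exp_sum, ← Complex.exp_sum, ← sum_sum_Iic_mul]
    congr 1
    refine Finset.sum_congr rfl fun j _ => ?_
    rw [coneSum, Complex.ofReal_sum]
  unfold companionTerm
  simp_rw [Finset.prod_mul_distrib, Finset.prod_div_distrib, Finset.prod_mul_distrib, hexp]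

lemma I_zpow_sum {m : ℕ} (n : Fin m → ℤ) :
    Complex.I ^ ((∑ j, n j) - (m : ℤ)) = ∏ j, Complex.I ^ (n j - 1) := by
  have h1 : ∀ s : Finset (Fin m), Complex.I ^ (∑ j ∈ s, (n j - 1)) =
      ∏ j ∈ s, Complex.I ^ (n j - 1) := by
    intro s
    induction s using Finset.induction_on with
    | empty => simp
    | insert a s ha ih =>
      rw [Finset.sum_insert ha, Finset.prod_insert ha, zpow_add₀ Complex.I_ne_zero, ih]
  rw [← h1]
  simp

/-- Each residue carries a factor `i`, and each partial sum of poles is `i` times the cone sum,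
which gives `i^{-n_j}`. The prefactor `i^{n_j - 1}` cancels both. -/
lemma I_zpow_mul_residueTerm (h : ℝ) {m : ℕ} (n : Fin m → ℤ) (w : Fin m → ℂ) (ε : Fin m → Bool)
    (k : Fin m → ℕ) : Complex.I ^ ((∑ j, n j) - (m : ℤ)) * residueTerm h n (omega w) 0 ε k =
      companionTerm h n ε w k := by
  rw [I_zpow_sum, residueTerm, companionTerm_eq, ← Finset.prod_mul_distrib]
  refine Finset.prod_congr rfl fun j _ => ?_
  have h1 : (0 + ∑ i ∈ Finset.Iic j, (scale h (ε i) * k i : ℝ) * Complex.I : ℂ) =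
      (coneSum h ε k j : ℂ) * Complex.I := by
    rw [zero_add, ← Finset.sum_mul, coneSum, Complex.ofReal_sum]
  have hI : Complex.I ^ n j ≠ 0 := zpow_ne_zero _ Complex.I_ne_zero
  rw [h1, mul_zpow, zpow_sub_one₀ Complex.I_ne_zero, kernResidue]
  have h2 : Complex.I⁻¹ * Complex.I = 1 := inv_mul_cancel₀ Complex.I_ne_zero
  have h3 : Complex.I ^ n j * (Complex.I ^ n j)⁻¹ = 1 := mul_inv_cancel₀ hI
  rw [div_eq_mul_inv, div_eq_mul_inv, div_eq_mul_inv, mul_inv, mul_inv]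
  linear_combination (scale h (ε j) : ℂ) * ((-1) ^ k j *
    Complex.exp ((scale h (ε j) * k j : ℝ) * omega w j)) * (bracket (qBase h (ε j)) (k j))⁻¹ *
    ((coneSum h ε k j : ℂ) ^ n j)⁻¹ * (Complex.I ^ n j * (Complex.I ^ n j)⁻¹ * h2 + h3)

lemma sum_companionPartial (h R : ℝ) {m : ℕ} (n : Fin m → ℤ) (w : Fin m → ℂ) :
    ∑ ε : Fin m → Bool, companionPartial h n ε w R =
      Complex.I ^ ((∑ j, n j) - (m : ℤ)) * iterOp (resOp h R) m n (omega w) 0 := by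
  rw [iterOp_resOp, Finset.mul_sum]
  refine Finset.sum_congr rfl fun ε _ => ?_
  rw [companionPartial, Finset.mul_sum]
  exact Finset.sum_congr rfl fun k _ => (I_zpow_mul_residueTerm h n w ε k).symm

/-! ### Horizontal lines away from the poles -/

lemma FarLine.mono {h σ σ' T : ℝ} (hT : FarLine h σ T) (hσ : σ' ≤ σ) : FarLine h σ' T :=
  fun x => ⟨le_trans (by gcongr) (hT x).1, le_trans (by gcongr) (hT x).2⟩

lemma farLine_of_sin {h σ T : ℝ} (hh : 0 < h) (h1 : σ ≤ |Real.sin (Real.pi * T)|)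
    (h2 : σ ≤ |Real.sin (Real.pi * h * T)|) : FarLine h σ T := fun x =>
  poleFar_of_sin hh (by rwa [mk_im]) (by rwa [mk_im])

lemma exists_farLine_of_lt {h δ : ℝ} (hh : 0 < h) (hδ : 0 < δ) (hδs : ∀ b, δ < scale h b) :
    ∃ σ, 0 < σ ∧ FarLine h σ δ := by
  have h1 : δ < 1 := by simpa [scale] using hδs false
  have h2 : h * δ < 1 := by
    have : δ < h⁻¹ := by simpa [scale] using hδs true
    calc h * δ < h * h⁻¹ := by gcongr
      _ = 1 := mul_inv_cancel₀ hh.ne'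
  have s1 : 0 < Real.sin (Real.pi * δ) :=
    Real.sin_pos_of_pos_of_lt_pi (by positivity) (by nlinarith [Real.pi_pos])
  have s2 : 0 < Real.sin (Real.pi * h * δ) :=
    Real.sin_pos_of_pos_of_lt_pi (by positivity) (by nlinarith [Real.pi_pos])
  exact ⟨min (Real.sin (Real.pi * δ)) (Real.sin (Real.pi * h * δ)), lt_min s1 s2,
    farLine_of_sin hh ((min_le_left _ _).trans (le_abs_self _))
      ((min_le_right _ _).trans (le_abs_self _))⟩

lemma abs_sin_sub_le (a b : ℝ) : |Real.sin (a - b)| ≤ |Real.sin a| + |Real.sin b| := by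
  rw [Real.sin_sub]
  refine (abs_sub _ _).trans ?_
  rw [abs_mul, abs_mul]
  have := mul_le_of_le_one_right (abs_nonneg (Real.sin a)) (Real.abs_cos_le_one b)
  have := mul_le_of_le_one_left (abs_nonneg (Real.sin b)) (Real.abs_cos_le_one a)
  linarith

lemma abs_sin_pi_mul_add_half (N : ℕ) (y : ℝ) :
    |Real.sin (Real.pi * (N + 1 / 2 + y))| = |Real.cos (Real.pi * y)| := by
  rw [show Real.pi * (N + 1 / 2 + y) = Real.pi * y + Real.pi / 2 + N * Real.pi by ring,
    Real.sin_add_nat_mul_pi, Real.sin_add_pi_div_two, abs_mul, abs_pow]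
  simp

/-- Arbitrarily high lines stay away from the poles, uniformly. -/
lemma exists_high_farLine {h : ℝ} (hh : 0 < h) :
    ∃ σ, 0 < σ ∧ ∀ N : ℕ, ∃ T : ℝ, N ≤ T ∧ FarLine h σ T := by
  -- Small enough that `η < 1/2` and `hη < 1`, so that `cos (πη)` and `sin (πhη)` are positive.
  set η : ℝ := 1 / (4 * (1 + h)) with hη
  have hη0 : 0 < η := by positivity
  have hη1 : η < 1 / 2 := by
    rw [hη, div_lt_div_iff₀ (by positivity) (by norm_num)]; linarith
  have hη2 : h * η < 1 := by
    rw [hη, mul_one_div, div_lt_one (by positivity)]; linarith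
  have hcos : 0 < Real.cos (Real.pi * η) :=
    Real.cos_pos_of_mem_Ioo ⟨by nlinarith [Real.pi_pos], by nlinarith [Real.pi_pos]⟩
  have hsin : 0 < Real.sin (Real.pi * h * η) :=
    Real.sin_pos_of_pos_of_lt_pi (by positivity) (by nlinarith [Real.pi_pos])
  refine ⟨min (Real.cos (Real.pi * η)) (Real.sin (Real.pi * h * η) / 2),
    lt_min hcos (by positivity), fun N => ?_⟩
  have hsum := abs_sin_sub_le (Real.pi * h * (N + 1 / 2 + η)) (Real.pi * h * (N + 1 / 2 + 0))
  rw [show Real.pi * h * (N + 1 / 2 + η) - Real.pi * h * (N + 1 / 2 + 0) = Real.pi * h * η by ring,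
    abs_of_pos hsin] at hsum
  -- Both heights `N + 1/2` and `N + 1/2 + η` are good for `sin (πT)`. Their arguments in `sin
  -- (πhT)` differ by `πhη`, so the two sines cannot both be smaller than half of `sin (πhη)`.
  rcases le_total (Real.sin (Real.pi * h * η) / 2)
    |Real.sin (Real.pi * h * (N + 1 / 2 + η))| with hle | hle
  · refine ⟨N + 1 / 2 + η, by linarith, farLine_of_sin hh ?_ ((min_le_right _ _).trans hle)⟩
    rw [abs_sin_pi_mul_add_half]
    exact (min_le_left _ _).trans (le_abs_self _)
  · refine ⟨N + 1 / 2 + 0, by linarith, farLine_of_sin hh ?_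
      ((min_le_right _ _).trans (by linarith))⟩
    rw [abs_sin_pi_mul_add_half]
    simpa using Or.inl (Real.cos_le_one _)

/-! ### Box sums of a convergent companion series -/

/-- For `k j = 0` the bracket is `0` and division by zero returns `0`. A sum over positive indices
may thus be taken over all of `ℕ`. -/
lemma companionTerm_eq_zero (h : ℝ) {m : ℕ} (n : Fin m → ℤ) (ε : Fin m → Bool) (w : Fin m → ℂ)
    {k : Fin m → ℕ} {j : Fin m} (hj : k j = 0) : companionTerm h n ε w k = 0 :=
  Finset.prod_eq_zero (Finset.mem_univ j) (by simp [hj, bracket])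

lemma CompanionSummable.tendsto_companionPartial {h : ℝ} (hh : 0 < h) {m : ℕ} {n : Fin m → ℤ}
    {ε : Fin m → Bool} {w : Fin m → ℂ} (hs : CompanionSummable h n ε w) :
    Tendsto (companionPartial h n ε w) atTop (𝓝 (companionLi h n ε w)) := by
  have hinj : Function.Injective fun (k : Fin m → ℕ+) (j : Fin m) => (k j : ℕ) := fun k k' e =>
    funext fun j => PNat.coe_injective (congrFun e j)
  have hsum : HasSum (companionTerm h n ε w) (companionLi h n ε w) := by
    refine (hinj.hasSum_iff fun k hk => ?_).1 hs.hasSum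
    by_contra hne
    refine hk ⟨fun j => ⟨k j, Nat.pos_of_ne_zero fun hj =>
      hne (companionTerm_eq_zero h n ε w hj)⟩, rfl⟩
  -- The boxes are cofinal among finite sets, so unconditional convergence gives convergence along
  -- them. Including zero indices changes nothing.
  have hfin : Tendsto (fun R : ℝ => Fintype.piFinset fun j => Finset.Iic ⌊R / scale h (ε j)⌋₊)
      atTop atTop := by
    refine tendsto_atTop.2 fun s => ?_
    have : ∀ᶠ R : ℝ in atTop, ∀ k ∈ s, ∀ j, k j ≤ ⌊R / scale h (ε j)⌋₊ := by
      refine (Finset.eventually_all s).2 fun k _ => eventually_all.2 fun j => ?_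
      filter_upwards [eventually_ge_atTop (k j * scale h (ε j))] with R hR
      exact Nat.le_floor ((le_div_iff₀ (scale_pos hh _)).2 hR)
    filter_upwards [this] with R hR k hk
    simpa [Fintype.mem_piFinset] using hR k hk
  refine (hsum.comp hfin).congr fun R => ?_
  symm
  refine Finset.sum_subset (Fintype.piFinset_subset _ _ fun j => ?_) fun k hk hk' => ?_
  · intro l hl
    exact Finset.mem_Iic.2 (Finset.mem_Icc.1 hl).2
  · simp only [Fintype.mem_piFinset, Finset.mem_Iic] at hk
    simp only [Fintype.mem_piFinset, Finset.mem_Icc, not_forall, not_and] at hk'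
    obtain ⟨j, hj⟩ := hk'
    exact companionTerm_eq_zero h n ε w (j := j) (by
      by_contra h0
      exact hj (Nat.one_le_iff_ne_zero.2 h0) (hk j))

/-! ### Small denominators and absolute convergence -/

lemma two_mul_abs_le_abs_sin {y : ℝ} (hy : |y| ≤ 1 / 2) : 2 * |y| ≤ |Real.sin (Real.pi * y)| := by
  have h1 := Real.mul_abs_le_abs_sin (x := Real.pi * y) (by
    rw [abs_mul, abs_of_pos Real.pi_pos]
    nlinarith [Real.pi_pos])
  rw [abs_mul, abs_of_pos Real.pi_pos] at h1
  refine le_trans (le_of_eq ?_) h1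
  field_simp

lemma two_mul_abs_sub_round_le_abs_sin (x : ℝ) :
    2 * |x - round x| ≤ |Real.sin (Real.pi * x)| := by
  refine (two_mul_abs_le_abs_sin (abs_sub_round x)).trans (le_of_eq ?_)
  rw [show Real.pi * (x - round x) = Real.pi * x - round x * Real.pi by ring,
    Real.sin_sub_int_mul_pi, abs_mul, abs_zpow]
  simp

/-- The bracket is `sh` at the imaginary point `iπx` with `x = hk` or `k/h`, so it dominates `|sin
πx|`. Jordan's inequality bounds this sine below by twice the distance from `x` to the nearest
integer. -/
lemma abs_sub_round_le_norm_bracket (h : ℝ) (b : Bool) (k : ℕ) :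
    2 * |(if b then k / h else h * k) - round (if b then k / h else h * k)| ≤
      ‖bracket (qBase h b) k‖ := by
  refine (two_mul_abs_sub_round_le_abs_sin _).trans ?_
  have hb : bracket (qBase h b) k =
      sh (((Real.pi * (if b then k / h else h * k) : ℝ) : ℂ) * Complex.I) := by
    rw [qBase_pow]
    cases b <;> simp <;> ring_nf
  rw [hb]
  refine le_trans (le_of_eq ?_) (exp_abs_mul_abs_sin_le_norm_sh _)
  rw [Complex.re_ofReal_mul, Complex.im_ofReal_mul]
  simp

/-- If `h` is not exponentially well approximable, the brackets are not exponentially small. -/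
lemma exists_le_norm_bracket {h : ℝ} (hh : 0 < h)
    (hd : ∀ δ : ℝ, 0 < δ → ∃ C : ℝ, 0 < C ∧ ∀ a b : ℤ, 0 < b →
      C * Real.exp (-δ * b) ≤ |b * h - a|) (b : Bool) {δ : ℝ} (hδ : 0 < δ) :
    ∃ C : ℝ, 0 < C ∧ ∀ k : ℕ, 1 ≤ k →
      C * Real.exp (-δ * (scale h b * k)) ≤ ‖bracket (qBase h b) k‖ := by
  obtain ⟨C, hC, H⟩ := hd δ hδ
  cases b
  · refine ⟨2 * C, by positivity, fun k hk => ?_⟩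
    refine le_trans ?_ (abs_sub_round_le_norm_bracket h false k)
    have := H (round (h * k)) k (by exact_mod_cast hk)
    simp only [scale, Bool.false_eq_true, if_false, one_mul, mul_assoc]
    rw [mul_comm h]
    rw [mul_comm h] at this
    simpa using this
  · refine ⟨2 / h * min 1 (C * Real.exp (-δ / 2)), by positivity, fun k hk => ?_⟩
    refine le_trans ?_ (abs_sub_round_le_norm_bracket h true k)
    simp only [scale, if_true]
    set a := round ((k : ℝ) / h) with ha
    have hk1 : (1 : ℝ) ≤ k := by exact_mod_cast hk
    have e1 : 2 * |(k : ℝ) / h - a| = 2 / h * |a * h - k| := by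
      have : (k : ℝ) / h - a = -((a * h - k) / h) := by field_simp; ring
      rw [this, abs_neg, abs_div, abs_of_pos hh]
      ring
    rw [e1, mul_assoc]
    gcongr
    -- The approximation hypothesis needs a positive denominator; for `a ≤ 0` the distance `|ah -
    -- k|` is at least `k ≥ 1` anyway.
    rcases le_or_gt a 0 with ha0 | ha0
    · have ha' : (a : ℝ) ≤ 0 := by exact_mod_cast ha0
      have h1 : 1 ≤ |(a : ℝ) * h - k| := by
        rw [abs_of_nonpos (by nlinarith)]
        nlinarith
      refine le_trans ?_ h1
      refine mul_le_one₀ (min_le_left _ _) (Real.exp_pos _).le (Real.exp_le_one_iff.2 ?_)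
      have : 0 ≤ h⁻¹ * k := by positivity
      nlinarith
    -- The roles are exchanged: `k/a` approximates `h`. Since `a ≤ k/h + 1/2`, rewriting the bound
    -- in terms of `k/h` costs the factor `e^{-δ/2}`.
    · refine le_trans ?_ (H k a ha0)
      refine (mul_le_mul_of_nonneg_right (min_le_right _ _) (Real.exp_pos _).le).trans ?_
      rw [mul_assoc, ← Real.exp_add]
      gcongr
      have h2 := (abs_le.1 (abs_sub_round ((k : ℝ) / h))).1
      rw [← ha, div_eq_inv_mul (k : ℝ) h] at h2
      nlinarith

/-- Induction on the number of variables, with the shift `z` kept to absorb the earlier poles. The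
majorant is a product of geometric series, hence summable. -/
lemma exists_residueTerm_bound {h : ℝ} (hh : 0 < h)
    (hd : ∀ δ : ℝ, 0 < δ → ∃ C : ℝ, 0 < C ∧ ∀ a b : ℤ, 0 < b →
      C * Real.exp (-δ * b) ≤ |b * h - a|)
    {m : ℕ} (n : Fin m → ℤ) (ω : Fin m → ℂ) (hω : ∀ j, (ω j).re < 0) (ε : Fin m → Bool) :
    ∃ (N : ℕ) (G : (Fin m → ℕ+) → ℝ), Summable G ∧ ∀ z : ℂ, 0 ≤ z.im → ∀ k : Fin m → ℕ+,
      ‖residueTerm h n ω z ε fun j => (k j : ℕ)‖ ≤ G k * (1 + ‖z‖) ^ N := by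
  induction m with
  | zero =>
    exact ⟨0, fun _ => 1, Summable.of_finite, fun z _ k => by simp [residueTerm]⟩
  | succ m ih =>
    obtain ⟨N, G, hG, H⟩ := ih (Fin.tail n) (Fin.tail ω) (fun j => hω j.succ) fun j => ε j.succ
    -- Of the decay rate `ρ`, a quarter pays for the bracket and a quarter for the polynomial
    -- growth; the remaining `ρ/2` gives a geometric series.
    set ρ : ℝ := -(ω 0).re with hρ
    have hρ0 : 0 < ρ := by linarith [hω 0]
    set s : ℝ := scale h (ε 0) with hs
    have hs0 : 0 < s := scale_pos hh _
    set M := N + (n 0).natAbs with hM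
    obtain ⟨C1, hC1, H1⟩ := exists_le_norm_bracket hh hd (ε 0) (δ := ρ / 4) (by positivity)
    obtain ⟨C2, hC2, H2⟩ := exists_norm_zpow_inv_le (n 0) hs0
    obtain ⟨C3, hC3, H3⟩ := exists_one_add_pow_le_exp M (c := ρ / 4) (by positivity)
    have hGn : ∀ k, 0 ≤ G k := fun k => by
      simpa using (norm_nonneg _).trans (H 0 (by simp) k)
    set D : ℝ := s / C1 * C2 * C3 with hD
    have hD0 : 0 < D := by positivity
    have hgeo : Summable fun l : ℕ+ => D * Real.exp (-(ρ / 2) * s) ^ (l : ℕ) := by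
      refine (Summable.mul_left D ?_)
      refine (summable_geometric_of_lt_one (Real.exp_pos _).le ?_).comp_injective
        PNat.coe_injective
      rw [← Real.exp_zero, Real.exp_lt_exp]
      nlinarith [mul_pos hρ0 hs0]
    refine ⟨M, fun k => D * Real.exp (-(ρ / 2) * s) ^ (k 0 : ℕ) * G fun j => k j.succ, ?_,
      fun z hz k => ?_⟩
    · rw [← (Fin.consEquiv fun _ => ℕ+).summable_iff]
      exact hgeo.mul_of_nonneg hG (fun l => by positivity) hGn
    · rw [residueTerm_succ, ← hs]
      set l : ℕ := (k 0 : ℕ) with hl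
      have hl1 : 1 ≤ l := (k 0).pos
      have hsl : s ≤ s * l := le_mul_of_one_le_right hs0.le (by exact_mod_cast hl1)
      set u : ℂ := (s * l : ℝ) * Complex.I with hu
      have hun : ‖u‖ = s * l := by
        rw [hu, norm_mul, Complex.norm_I, mul_one, Complex.norm_real, Real.norm_of_nonneg]
        positivity
      have huim : u.im = s * l := by rw [hu, Complex.im_ofReal_mul, Complex.I_im, mul_one]
      have him : s ≤ (z + u).im := by rw [Complex.add_im, huim]; linarith
      have k1 := H (z + u) (hs0.le.trans him) fun j => k j.succ
      have k2 := H2 (z + u) (him.trans ((le_abs_self _).trans (Complex.abs_im_le_norm _)))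
      have k3 : (1 + ‖z + u‖) ^ M ≤ (1 + ‖z‖) ^ M * (C3 * Real.exp (ρ / 4 * (s * l))) := by
        calc (1 + ‖z + u‖) ^ M ≤ ((1 + ‖z‖) * (1 + ‖u‖)) ^ M := by
              gcongr
              exact one_add_norm_add_le z u
          _ ≤ _ := by
              rw [mul_pow, hun]
              gcongr
              exact H3 _ (by positivity)
      have k4 : ‖kernResidue h (ω 0) (ε 0) l‖ ≤
          s / C1 * (Real.exp (-ρ * (s * l)) * Real.exp (ρ / 4 * (s * l))) := by
        have e1 : ‖Complex.exp ((s * l : ℝ) * ω 0)‖ = Real.exp (-ρ * (s * l)) := by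
          rw [Complex.norm_exp, Complex.re_ofReal_mul, hρ]
          ring_nf
        have e2 : ‖bracket (qBase h (ε 0)) l‖⁻¹ ≤ C1⁻¹ * Real.exp (ρ / 4 * (s * l)) := by
          refine (inv_anti₀ (by positivity) (H1 l hl1)).trans (le_of_eq ?_)
          rw [mul_inv, ← Real.exp_neg, ← hs]
          ring_nf
        rw [kernResidue, ← hs, norm_mul, norm_mul, norm_div, norm_mul, norm_pow, norm_neg,
          norm_one, one_pow, one_mul, Complex.norm_I, one_mul, e1, Complex.norm_real,
          Real.norm_of_nonneg hs0.le, div_eq_mul_inv]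
        calc s * (Real.exp (-ρ * (s * l)) * ‖bracket (qBase h (ε 0)) l‖⁻¹)
            ≤ s * (Real.exp (-ρ * (s * l)) * (C1⁻¹ * Real.exp (ρ / 4 * (s * l)))) := by gcongr
          _ = _ := by ring
      have k5 : Real.exp (-(ρ / 2) * s) ^ l = Real.exp (-ρ * (s * l)) *
          Real.exp (ρ / 4 * (s * l)) * Real.exp (ρ / 4 * (s * l)) := by
        rw [← Real.exp_nat_mul, ← Real.exp_add, ← Real.exp_add]
        ring_nf
      have hg := hGn fun j => k j.succ
      simp only
      rw [norm_mul, norm_div, div_eq_mul_inv, ← hl, k5]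
      calc _ ≤ (s / C1 * (Real.exp (-ρ * (s * l)) * Real.exp (ρ / 4 * (s * l)))) *
            ((G (fun j => k j.succ) * (1 + ‖z + u‖) ^ N) *
              (C2 * (1 + ‖z + u‖) ^ (n 0).natAbs)) := by
            gcongr
        _ = (s / C1 * (Real.exp (-ρ * (s * l)) * Real.exp (ρ / 4 * (s * l)))) *
            G (fun j => k j.succ) * C2 * (1 + ‖z + u‖) ^ M := by rw [hM, pow_add]; ring
        _ ≤ (s / C1 * (Real.exp (-ρ * (s * l)) * Real.exp (ρ / 4 * (s * l)))) *
            G (fun j => k j.succ) * C2 *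
              ((1 + ‖z‖) ^ M * (C3 * Real.exp (ρ / 4 * (s * l)))) := by gcongr
        _ = _ := by rw [hD]; ring

lemma companionSummable_of_diophantine {h : ℝ} (hh : 0 < h)
    (hd : ∀ δ : ℝ, 0 < δ → ∃ C : ℝ, 0 < C ∧ ∀ a b : ℤ, 0 < b →
      C * Real.exp (-δ * b) ≤ |b * h - a|)
    {m : ℕ} (n : Fin m → ℤ) (w : Fin m → ℂ) (hre : ∀ j, (omega w j).re < 0) (ε : Fin m → Bool) :
    CompanionSummable h n ε w := by
  obtain ⟨N, G, hG, H⟩ := exists_residueTerm_bound hh hd n (omega w) hre ε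
  have : Summable fun k : Fin m → ℕ+ => residueTerm h n (omega w) 0 ε fun j => (k j : ℕ) :=
    Summable.of_norm_bounded hG fun k => by simpa using H 0 (by simp) k
  refine (this.mul_left (Complex.I ^ ((∑ j, n j) - (m : ℤ)))).congr fun k => ?_
  exact I_zpow_mul_residueTerm h n w ε _

/-! ### Assembling the theorem -/

lemma contourIntegral_eq {h σ δ : ℝ} (hσ : 0 < σ) (hδ : 0 < δ) (hfδ : FarLine h σ δ) {m : ℕ}
    (n : Fin m → ℤ) (w : Fin m → ℂ) (hω : ∀ j, Admissible h (omega w j)) :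
    contourIntegral h n w δ = Complex.I ^ ((∑ j, n j) - (m : ℤ)) *
      iterOp (lineOp h δ) m n (omega w) 0 := by
  rw [contourIntegral]
  simp_rw [integrand_eq]
  rw [integral_shiftedIntegrand hσ hδ hfδ n (omega w) hω (by simp)]

lemma tendsto_sum_companionPartial {h σ δ : ℝ} (hh : 0 < h) (hi : Irrational h) (hσ : 0 < σ)
    (hδ : 0 < δ) (hδs : ∀ b, δ < scale h b) (hfδ : FarLine h σ δ) {m : ℕ} (n : Fin m → ℤ)
    (w : Fin m → ℂ) (hω : ∀ j, Admissible h (omega w j)) {R : ℕ → ℝ}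
    (hR : Tendsto R atTop atTop) (hfR : ∀ N, FarLine h σ (R N)) :
    Tendsto (fun N => ∑ ε : Fin m → Bool, companionPartial h n ε w (R N)) atTop
      (𝓝 (contourIntegral h n w δ)) := by
  rw [contourIntegral_eq hσ hδ hfδ n w hω]
  simp_rw [sum_companionPartial]
  refine Tendsto.const_mul _ ?_
  obtain ⟨N, A, B, c, hc, hB, H⟩ := exists_iterOp_bounds hσ hδ hfδ m n (omega w) hω
  rw [tendsto_iff_norm_sub_tendsto_zero]
  have h0 : Tendsto (fun N => B * Real.exp (-c * R N)) atTop (𝓝 (B * 0)) := by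
    refine (Real.tendsto_exp_atBot.comp ?_).const_mul B
    simpa only [neg_mul, Function.comp_def] using
      tendsto_neg_atTop_atBot.comp (hR.const_mul_atTop hc)
  rw [mul_zero] at h0
  refine squeeze_zero' (Eventually.of_forall fun _ => norm_nonneg _) ?_ h0
  filter_upwards [hR.eventually_ge_atTop δ] with M hM
  rw [← iterOp_stripOp_eq hh hi hσ hδ hδs hfδ hM (hfR M) m n (omega w) hω (by simp)]
  simpa using (H (R M) hM (hfR M)).2.2 0 (by simp)

end QuantumPolylog

end

theorem mainTheorem7 (h : ℝ) (h_pos : 0 < h) (h_irr : Irrational h)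
    (m : ℕ) (n : Fin m → ℤ) (w : Fin m → ℂ)
    (hre : ∀ j, (QuantumPolylog.omega w j).re < 0)
    (him : ∀ j, |(QuantumPolylog.omega w j).im| < Real.pi * (1 + h)) :
    -- the integral defining the basic quantum polylogarithm converges
    (∀ᶠ δ : ℝ in 𝓝[>] 0, Integrable fun x : Fin m → ℝ =>
      QuantumPolylog.integrand h n w (QuantumPolylog.contourPoint δ x)) ∧
    Tendsto (QuantumPolylog.contourIntegral h n w) (𝓝[>] 0)
      (𝓝 (QuantumPolylog.basicQuantumPolylog h n w)) ∧
    -- it is the sum of the `2 ^ m` companion series, whenever these converge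
    ((∀ ε : Fin m → Bool, QuantumPolylog.CompanionSummable h n ε w) →
      QuantumPolylog.basicQuantumPolylog h n w =
        ∑ ε : Fin m → Bool, QuantumPolylog.companionLi h n ε w) ∧
    -- they converge unless `h` is exponentially well approximable by rational numbers
    ((∀ δ : ℝ, 0 < δ → ∃ C : ℝ, 0 < C ∧ ∀ a b : ℤ, 0 < b →
        C * Real.exp (-δ * b) ≤ |b * h - a|) →
      ∀ ε : Fin m → Bool, QuantumPolylog.CompanionSummable h n ε w) ∧
    -- for every irrational `h` the equality holds with the series summed jointly over boxes
    ∃ R : ℕ → ℝ, Tendsto R atTop atTop ∧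
      Tendsto (fun N => ∑ ε : Fin m → Bool, QuantumPolylog.companionPartial h n ε w (R N)) atTop
        (𝓝 (QuantumPolylog.basicQuantumPolylog h n w)) := by
  open QuantumPolylog in
  have hω : ∀ j, Admissible h (omega w j) := fun j => ⟨hre j, him j⟩
  -- A height below the first poles `i` and `i/h`; the contour integral is constant on `(0, δ]`, so
  -- its limit is its value at `δ`.
  obtain ⟨δ, hδ, hδs⟩ : ∃ δ : ℝ, 0 < δ ∧ ∀ b, δ < scale h b := by
    refine ⟨min (scale h false) (scale h true) / 2, ?_, fun b => ?_⟩
    · exact half_pos (lt_min (scale_pos h_pos _) (scale_pos h_pos _))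
    · refine (half_lt_self (lt_min (scale_pos h_pos _) (scale_pos h_pos _))).trans_le ?_
      cases b
      exacts [min_le_left _ _, min_le_right _ _]
  have hlow : ∀ᶠ t : ℝ in 𝓝[>] 0, 0 < t ∧ t ≤ δ := Ioc_mem_nhdsGT hδ
  have hfar : ∀ t : ℝ, 0 < t ∧ t ≤ δ → ∃ σ, 0 < σ ∧ FarLine h σ t ∧ FarLine h σ δ := by
    rintro t ⟨ht, htδ⟩
    obtain ⟨σ, hσ, hf⟩ := exists_farLine_of_lt h_pos ht fun b => htδ.trans_lt (hδs b)
    obtain ⟨σ', hσ', hf'⟩ := exists_farLine_of_lt h_pos hδ hδs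
    exact ⟨min σ σ', lt_min hσ hσ', hf.mono (min_le_left _ _), hf'.mono (min_le_right _ _)⟩
  have hconst : Tendsto (contourIntegral h n w) (𝓝[>] 0) (𝓝 (contourIntegral h n w δ)) := by
    refine tendsto_const_nhds.congr' ?_
    filter_upwards [hlow] with t ht
    obtain ⟨σ, hσ, hf, hf'⟩ := hfar t ht
    rw [contourIntegral_eq hσ ht.1 hf n w hω, contourIntegral_eq hσ hδ hf' n w hω,
      iterOp_lineOp_eq h_pos h_irr hσ ht.1 hδs hf ht.2 hf' m n _ hω (by simp)]
  have hbasic : basicQuantumPolylog h n w = contourIntegral h n w δ := hconst.limUnder_eq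
  obtain ⟨R, hR, hRlim⟩ : ∃ R : ℕ → ℝ, Tendsto R atTop atTop ∧
      Tendsto (fun N => ∑ ε : Fin m → Bool, companionPartial h n ε w (R N)) atTop
        (𝓝 (contourIntegral h n w δ)) := by
    obtain ⟨σ, hσ, hf⟩ := exists_farLine_of_lt h_pos hδ hδs
    obtain ⟨σ', hσ', hhigh⟩ := exists_high_farLine h_pos
    choose R hRN hfR using hhigh
    have hR : Tendsto R atTop atTop := tendsto_atTop_mono hRN tendsto_natCast_atTop_atTop
    exact ⟨R, hR, tendsto_sum_companionPartial h_pos h_irr (lt_min hσ hσ') hδ hδs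
      (hf.mono (min_le_left _ _)) n w hω hR fun N => (hfR N).mono (min_le_right _ _)⟩
  rw [hbasic]
  refine ⟨?_, hconst, fun hs => ?_, fun hd ε =>
    companionSummable_of_diophantine h_pos hd n w hre ε, R, hR, hRlim⟩
  · filter_upwards [hlow] with t ht
    obtain ⟨σ, hσ, hf, -⟩ := hfar t ht
    simp_rw [integrand_eq]
    exact integrable_shiftedIntegrand hσ ht.1 hf n _ hω (by simp)
  -- When the individual series converge, their box sums along the same heights tend to the sum of
  -- the series, and limits are unique.
  · refine tendsto_nhds_unique hRlim (tendsto_finsetSum _ fun ε _ => ?_)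
    exact ((hs ε).tendsto_companionPartial h_pos).comp hR
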